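/- Theorem 1.2. Let $t>0$ and $0<\alpha\le 2$. Let $\Delta_\alpha=\{z\in\mathbb{C}\setminus\{0\}:|\arg z|<\pi\alpha/4\}$, let $dA$ be Lebesgue measure, let all complex powers be principal branches, and let $B$ be the Beta function. For $g\in L^2_{\mathbb{C}}((0,t),\tau^\alpha d\tau/t^\alpha)$ and $z\in\Delta_\alpha$ put $$\mathcal{L}_t^{\alpha}g(z)=\frac{(\alpha/2)^\alpha}{\Gamma(\alpha/2)\,t^{\alpha}}\int_0^t\frac{z}{(t-\tau)^{\alpha/2+1}}\exp\left(-\frac{\alpha^2z^{2/\alpha}}{4(t-\tau)}\right)g(\tau)\,\tau^{\alpha}\,d\tau .$$ Let $A^2_{\alpha-1}(\Delta_\alpha)$ be the space of all holomorphic $f$ on $\Delta_\alpha$ with $\int_{\Delta_\alpha}|f(z)|^2(\Re z^{2/\alpha})^{\alpha-1}|z|^{(\alpha-2)(\alpha-1)/\alpha}dA(z)<\infty$, with the inner product $$\langle f,h\rangle=(\alpha\pi^{1/2})^{\alpha-1}\int_{\Delta_\alpha}f(z)\overline{h(z)}\,(\Re z^{2/\alpha})^{\alpha-1}|z|^{(\alpha-2)(\alpha-1)/\alpha}dA(z),$$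 and let $\mathcal{G}_\alpha^t=z^{(\alpha-1)(\alpha+2)/(2\alpha)}e^{-\frac{\alpha^2}{4t}z^{2/\alpha}}A^2_{\alpha-1}(\Delta_\alpha)$ with the norm $$\|F\|_{\mathcal{G}_\alpha^t}=\frac{B(\alpha/2,\alpha/2)^{1/2}}{(\alpha/2)^{(\alpha-1)/2}\pi^{(\alpha+1)/4}}\left\|z^{(1-\alpha)(\alpha+2)/(2\alpha)}e^{\frac{\alpha^2}{4t}z^{2/\alpha}}F\right\|_{A^2_{\alpha-1}(\Delta_\alpha)} .$$ Then the integral defining $\mathcal{L}_t^{\alpha}g(z)$ converges absolutely, and $\mathcal{L}_t^{\alpha}$ is an isometric linear isomorphism of $L^2_{\mathbb{C}}((0,t),\tau^\alpha d\tau/t^\alpha)$ onto $\mathcal{G}_\alpha^t$. Furthermore, let $$d\mu_\alpha^t(z)=\pi^{-1}2^{\alpha-1}B(\alpha/2,\alpha/2)\,|z|^{4(1-\alpha)/\alpha}e^{\frac{\alpha^2}{2t}\Re(z^{2/\alpha})}(\Re z^{2/\alpha})^{\alpha-1}dA(z),\qquad z\in\Delta_\alpha,$$ and let $(E_N)$ be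 any compact exhaustion of $\Delta_\alpha$ (an increasing sequence of compact sets with union $\Delta_\alpha$). Then for every $F\in\mathcal{G}_\alpha^t$ the functions $$\tau\mapsto\frac{(\alpha/2)^\alpha}{\Gamma(\alpha/2)(t-\tau)^{\alpha/2+1}}\int_{E_N}\overline{z}F(z)\exp\left(-\frac{\alpha^2\,\overline{z}^{\,2/\alpha}}{4(t-\tau)}\right)d\mu_\alpha^t(z)$$ are well defined (the integrals converge absolutely for all $\tau\in(0,t)$), belong to $L^2((0,t),\tau^\alpha d\tau/t^\alpha)$, and converge in that space to $(\mathcal{L}_t^{\alpha})^{-1}F$ as $N\to\infty$. -/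

import Mathlib

open MeasureTheory Filter Topology

noncomputable section

/-- The open sector `Δ_α = {z ≠ 0 : |arg z| < π α / 4}` (symmetric about the positive real axis). -/
def sector (α : ℝ) : Set ℂ :=
  {z | z ≠ 0 ∧ |Complex.arg z| < Real.pi * α / 4}

/-- The real part of `z ^ (2 / α)` (principal branch); it is positive on `Δ_α` for `0 < α ≤ 2`. -/
def rePow (α : ℝ) (z : ℂ) : ℝ :=
  (z ^ ((2 / α : ℝ) : ℂ)).re

/-- The measure `τ ^ α dτ / t ^ α` on the interval `(0, t)`. -/
def dataMeasure (α t : ℝ) : Measure ℝ :=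
  (volume.restrict (Set.Ioo 0 t)).withDensity fun τ => ENNReal.ofReal (τ ^ α / t ^ α)

/-- The integrand `z (t - τ) ^ (-(α/2 + 1)) exp (-α² z ^ (2/α) / (4 (t - τ))) g(τ) τ ^ α`
of the operator `L_t^α`. -/
def operatorIntegrand (α t : ℝ) (g : ℝ → ℂ) (z : ℂ) (τ : ℝ) : ℂ :=
  z / (((t - τ) ^ (α / 2 + 1) : ℝ) : ℂ) *
    Complex.exp (-((α : ℂ) ^ 2 * z ^ ((2 / α : ℝ) : ℂ)) / (4 * ((t : ℂ) - (τ : ℂ)))) *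
    g τ * ((τ ^ α : ℝ) : ℂ)

/-- The operator `L_t^α`: for `g` on `(0, t)` it gives the function
`z ↦ (α/2)^α / (Γ(α/2) t^α) ∫_0^t z (t-τ)^(-(α/2+1)) exp (-α² z^(2/α) / (4(t-τ))) g(τ) τ^α dτ`
on the sector `Δ_α`. -/
def sectorOperator (α t : ℝ) (g : ℝ → ℂ) (z : sector α) : ℂ :=
  (((α / 2) ^ α / (Real.Gamma (α / 2) * t ^ α) : ℝ) : ℂ) *
    ∫ τ in Set.Ioo 0 t, operatorIntegrand α t g z τ

/-- The area (Lebesgue) measure `dA` on the sector `Δ_α`. -/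
def areaMeasure (α : ℝ) : Measure (sector α) :=
  (volume : Measure ℂ).comap Subtype.val

/-- A function on the sector `Δ_α` is holomorphic. -/
def HolomorphicOnSector (α : ℝ) (f : sector α → ℂ) : Prop :=
  ∃ h : ℂ → ℂ, DifferentiableOn ℂ h (sector α) ∧ ∀ z : sector α, f z = h z

/-- The weight `(Re z^(2/α))^(α-1) |z|^((α-2)(α-1)/α)`. -/
def bergmanWeight (α : ℝ) (z : ℂ) : ℝ :=
  rePow α z ^ (α - 1) * ‖z‖ ^ ((α - 2) * (α - 1) / α)

lemma HolomorphicOnSector.continuous {α : ℝ} {f : sector α → ℂ}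
    (hf : HolomorphicOnSector α f) : Continuous f := by
  obtain ⟨h, hh, hfh⟩ := hf
  have : f = (sector α).domRestrict h := funext hfh
  rw [this]
  exact continuousOn_iff_continuous_domRestrict.1 hh.continuousOn

lemma measurable_rePow (α : ℝ) : Measurable (rePow α) := by
  unfold rePow
  fun_prop

lemma measurable_bergmanWeight (α : ℝ) : Measurable (bergmanWeight α) := by
  have := measurable_rePow α
  unfold bergmanWeight
  fun_prop

/-- The weighted Bergman space `A²_{α-1}(Δ_α)`: the holomorphic functions `f` on `Δ_α` with
`∫ |f(z)|² (Re z^(2/α))^(α-1) |z|^((α-2)(α-1)/α) dA(z) < ∞`. -/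
def bergmanSpace (α : ℝ) : Submodule ℂ (sector α → ℂ) where
  carrier := {f | HolomorphicOnSector α f ∧
    Integrable (fun z : sector α => ‖f z‖ ^ 2 * bergmanWeight α z) (areaMeasure α)}
  zero_mem' := ⟨⟨0, differentiableOn_const 0, fun _ => rfl⟩, by simp⟩
  add_mem' := by
    rintro f g ⟨hf, hfi⟩ ⟨hg, hgi⟩
    refine ⟨?_, ?_⟩
    · obtain ⟨F, hF, hfF⟩ := hf
      obtain ⟨G, hG, hgG⟩ := hg
      exact ⟨F + G, hF.add hG, fun z => by simp [hfF, hgG]⟩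
    · have hw : Measurable fun z : sector α => bergmanWeight α z :=
        (measurable_bergmanWeight α).comp measurable_subtype_coe
      refine ((hfi.norm.const_mul 2).add (hgi.norm.const_mul 2)).mono' ?_ (.of_forall fun z => ?_)
      · exact (((hf.continuous.add hg.continuous).norm.pow 2).measurable.mul
          hw).aestronglyMeasurable
      · have h1 : ‖(f + g) z‖ ^ 2 ≤ 2 * ‖f z‖ ^ 2 + 2 * ‖g z‖ ^ 2 := by
          have h2 : ‖(f + g) z‖ ≤ ‖f z‖ + ‖g z‖ := norm_add_le (f z) (g z)
          nlinarith [sq_nonneg (‖f z‖ - ‖g z‖), norm_nonneg ((f + g) z)]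
        have h3 := mul_le_mul_of_nonneg_right h1 (norm_nonneg (bergmanWeight α z))
        simp only [Pi.add_apply, norm_mul, norm_pow, norm_norm] at h3 ⊢
        linarith
  smul_mem' := by
    rintro c f ⟨hf, hfi⟩
    refine ⟨?_, ?_⟩
    · obtain ⟨F, hF, hfF⟩ := hf
      exact ⟨c • F, hF.const_smul c, fun z => by simp [hfF]⟩
    · refine (hfi.const_mul (‖c‖ ^ 2)).congr (.of_forall fun z => ?_)
      simp [mul_pow, mul_assoc]

/-- The inner product of `A²_{α-1}(Δ_α)`:
`⟨f, g⟩ = (α π^(1/2))^(α-1) ∫ f(z) conj(g(z)) (Re z^(2/α))^(α-1) |z|^((α-2)(α-1)/α) dA(z)`. -/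
def bergmanInner (α : ℝ) (f g : sector α → ℂ) : ℂ :=
  (((α * Real.pi ^ (1 / 2 : ℝ)) ^ (α - 1) : ℝ) : ℂ) *
    ∫ z : sector α, f z * (starRingEnd ℂ) (g z) * ((bergmanWeight α z : ℝ) : ℂ) ∂(areaMeasure α)

/-- The norm of `A²_{α-1}(Δ_α)`. -/
def bergmanNorm (α : ℝ) (f : sector α → ℂ) : ℝ :=
  Real.sqrt (bergmanInner α f f).re

/-- The multiplier `z^((α-1)(α+2)/(2α)) exp (-α² z^(2/α) / (4t))` on `Δ_α`. -/
def imageMultiplier (α t : ℝ) (z : sector α) : ℂ :=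
  (z : ℂ) ^ (((α - 1) * (α + 2) / (2 * α) : ℝ) : ℂ) *
    Complex.exp (-((α : ℂ) ^ 2 / (4 * (t : ℂ))) * (z : ℂ) ^ ((2 / α : ℝ) : ℂ))

/-- The space `𝒢_α^t = z^((α-1)(α+2)/(2α)) exp (-α² z^(2/α) / (4t)) A²_{α-1}(Δ_α)`. -/
def imageSpace (α t : ℝ) : Submodule ℂ (sector α → ℂ) :=
  (bergmanSpace α).map (LinearMap.mulLeft ℂ (imageMultiplier α t))

/-- The norm of `𝒢_α^t`:
`‖F‖ = B(α/2, α/2)^(1/2) / ((α/2)^((α-1)/2) π^((α+1)/4))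
  * ‖z^((1-α)(α+2)/(2α)) exp (α² z^(2/α) / (4t)) F‖`, the norm on the right being that of
`A²_{α-1}(Δ_α)`. -/
def imageNorm (α t : ℝ) (F : sector α → ℂ) : ℝ :=
  ProbabilityTheory.beta (α / 2) (α / 2) ^ (1 / 2 : ℝ) /
      ((α / 2) ^ ((α - 1) / 2) * Real.pi ^ ((α + 1) / 4)) *
    bergmanNorm α fun z =>
      (z : ℂ) ^ (((1 - α) * (α + 2) / (2 * α) : ℝ) : ℂ) *
        Complex.exp (((α : ℂ) ^ 2 / (4 * (t : ℂ))) * (z : ℂ) ^ ((2 / α : ℝ) : ℂ)) * F z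

/-- The measure `dμ_α^t(z) = π⁻¹ 2^(α-1) B(α/2, α/2) |z|^(4(1-α)/α) exp (α² Re(z^(2/α)) / (2t))
(Re z^(2/α))^(α-1) dA(z)` on `Δ_α`. -/
def sectorMeasure (α t : ℝ) : Measure (sector α) :=
  (areaMeasure α).withDensity fun z =>
    ENNReal.ofReal (Real.pi⁻¹ * 2 ^ (α - 1) * ProbabilityTheory.beta (α / 2) (α / 2) *
      ‖(z : ℂ)‖ ^ (4 * (1 - α) / α) * Real.exp (α ^ 2 / (2 * t) * rePow α z) *
      rePow α z ^ (α - 1))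

/-- The integrand `conj(z) F(z) exp (-α² conj(z)^(2/α) / (4 (t - τ)))` of the inverse formula. -/
def inverseIntegrand (α t : ℝ) (F : sector α → ℂ) (τ : ℝ) (z : sector α) : ℂ :=
  (starRingEnd ℂ) (z : ℂ) * F z *
    Complex.exp (-((α : ℂ) ^ 2 * ((starRingEnd ℂ) (z : ℂ)) ^ ((2 / α : ℝ) : ℂ)) /
      (4 * ((t : ℂ) - (τ : ℂ))))

/-- The truncated inverse transform, over a subset `E` of `Δ_α`:
`τ ↦ (α/2)^α / (Γ(α/2) (t-τ)^(α/2+1)) ∫_E conj(z) F(z) exp (-α² conj(z)^(2/α) / (4(t-τ))) dμ_α^t(z)`.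
-/
def truncatedInverse (α t : ℝ) (F : sector α → ℂ) (E : Set (sector α)) (τ : ℝ) : ℂ :=
  (((α / 2) ^ α / (Real.Gamma (α / 2) * (t - τ) ^ (α / 2 + 1)) : ℝ) : ℂ) *
    ∫ z in E, inverseIntegrand α t F τ z ∂(sectorMeasure α t)

end

/-!
`L_t^α g(z)` is an inner product `⟪k_z, g⟫` in `L²((0, t), τ^α dτ / t^α)`. In the variable
`(t - τ)⁻¹ - t⁻¹` the Gram kernel `⟪k_z, k_{z₀}⟫` is a Gamma integral, and it equals the reproducing
kernel of `𝒢_α^t`: the map `w = z^(2/α)` turns `𝒢_α^t` into the weighted Bergman space of the right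
half-plane, whose reproducing formula becomes the mean value property on the unit disc after a
Cayley transform. Along the line `z^(2/α) = 1 + ix` the operator is a Fourier transform, so the
vectors `k_z` are total, and equality of the kernels makes `L_t^α` an isometry into `L²(dμ_α^t)`.
Every `F` in `𝒢_α^t` is reproduced by the kernel, which says that the adjoint inverts `L_t^α`; the
truncated integrals are the adjoint applied to `1_{E_N} F`, and `1_{E_N} F → F` in `L²(dμ_α^t)`.
-/

open scoped ComplexConjugate InnerProductSpace

section ReproducingKernel

variable {𝕜 X H : Type*} [RCLike 𝕜] [MeasurableSpace X] {μ : Measure X}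
  [NormedAddCommGroup H] [InnerProductSpace 𝕜 H] {k : X → H}

variable (𝕜 μ k) in
/-- A family `k` of vectors such that the functions `⟪k ·, k x⟫` lie in `L²(μ)` and reproduce each
other there; `⟪k y, k x⟫` is then the kernel of a reproducing kernel Hilbert space whose norm is
that of `L²(μ)`. -/
structure IsReproducingFamily : Prop where
  memLp (x : X) : MemLp (fun y => ⟪k y, k x⟫_𝕜) 2 μ
  integral_inner_mul_conj_inner (x x' : X) :
    ∫ y, ⟪k y, k x⟫_𝕜 * conj ⟪k y, k x'⟫_𝕜 ∂μ = ⟪k x', k x⟫_𝕜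

namespace IsReproducingFamily

lemma memLp_inner_of_mem_span (hk : IsReproducingFamily 𝕜 μ k) {g : H}
    (hg : g ∈ Submodule.span 𝕜 (Set.range k)) : MemLp (fun y => ⟪k y, g⟫_𝕜) 2 μ := by
  induction hg using Submodule.span_induction with
  | mem _ hx => obtain ⟨x, rfl⟩ := hx; exact hk.memLp x
  | zero => simp
  | add _ _ _ _ hx hy => simp only [inner_add_right]; exact hx.add hy
  | smul c _ _ hx => simpa only [inner_smul_right, smul_eq_mul] using hx.const_mul c

lemma integral_inner_mul_conj_inner_of_mem_span (hk : IsReproducingFamily 𝕜 μ k) {g g' : H}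
    (hg : g ∈ Submodule.span 𝕜 (Set.range k)) (hg' : g' ∈ Submodule.span 𝕜 (Set.range k)) :
    ∫ y, ⟪k y, g⟫_𝕜 * conj ⟪k y, g'⟫_𝕜 ∂μ = ⟪g', g⟫_𝕜 := by
  have hint {f f' : H} (hf : f ∈ Submodule.span 𝕜 (Set.range k))
      (hf' : f' ∈ Submodule.span 𝕜 (Set.range k)) :
      Integrable (fun y => ⟪k y, f⟫_𝕜 * conj ⟪k y, f'⟫_𝕜) μ :=
    (hk.memLp_inner_of_mem_span hf).integrable_mul (hk.memLp_inner_of_mem_span hf').star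
  induction hg, hg' using Submodule.span_induction₂ with
  | mem_mem _ _ hx hy =>
    obtain ⟨x, rfl⟩ := hx
    obtain ⟨y, rfl⟩ := hy
    exact hk.integral_inner_mul_conj_inner x y
  | zero_left => simp
  | zero_right => simp
  | add_left x y z hx hy hz ihx ihy =>
    simp only [inner_add_right, add_mul]
    rw [integral_add (hint hx hz) (hint hy hz), ihx, ihy]
  | add_right x y z hx hy hz ihy ihz =>
    simp only [inner_add_right, map_add, mul_add, inner_add_left]
    rw [integral_add (hint hx hy) (hint hx hz), ihy, ihz]
  | smul_left r x y hx hy ih =>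
    simp only [inner_smul_right, mul_assoc]
    rw [integral_const_mul, ih]
  | smul_right r x y hx hy ih =>
    simp only [inner_smul_right, inner_smul_left, map_mul, mul_left_comm _ (conj r)]
    rw [integral_const_mul, ih]

lemma eLpNorm_inner_of_mem_span (hk : IsReproducingFamily 𝕜 μ k) {g : H}
    (hg : g ∈ Submodule.span 𝕜 (Set.range k)) : eLpNorm (fun y => ⟪k y, g⟫_𝕜) 2 μ = ‖g‖ₑ := by
  have hmem := hk.memLp_inner_of_mem_span hg
  have hinner : ⟪hmem.toLp, hmem.toLp⟫_𝕜 = ⟪g, g⟫_𝕜 := by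
    rw [L2.inner_def, ← hk.integral_inner_mul_conj_inner_of_mem_span hg hg]
    refine integral_congr_ae ?_
    filter_upwards [hmem.coeFn_toLp] with y hy
    rw [hy, RCLike.inner_apply]
  have hnorm : ‖hmem.toLp‖ = ‖g‖ := by
    rw [inner_self_eq_norm_sq_to_K, inner_self_eq_norm_sq_to_K] at hinner
    exact (sq_eq_sq₀ (norm_nonneg _) (norm_nonneg _)).1 (by exact_mod_cast hinner)
  rw [← ofReal_norm, ← hnorm, Lp.norm_toLp, ENNReal.ofReal_toReal hmem.2.ne]

omit [MeasurableSpace X] in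
lemma exists_seq_tendsto_inner (htot : Dense (Submodule.span 𝕜 (Set.range k) : Set H)) (g : H) :
    ∃ u : ℕ → H, (∀ n, u n ∈ Submodule.span 𝕜 (Set.range k)) ∧ Tendsto u atTop (𝓝 g) ∧
      ∀ y, Tendsto (fun n => ⟪k y, u n⟫_𝕜) atTop (𝓝 ⟪k y, g⟫_𝕜) := by
  obtain ⟨u, hu, hug⟩ := mem_closure_iff_seq_limit.1 (htot g)
  exact ⟨u, hu, hug, fun y => tendsto_const_nhds.inner hug⟩

lemma eLpNorm_inner_le (hk : IsReproducingFamily 𝕜 μ k)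
    (htot : Dense (Submodule.span 𝕜 (Set.range k) : Set H)) (g : H) :
    eLpNorm (fun y => ⟪k y, g⟫_𝕜) 2 μ ≤ ‖g‖ₑ := by
  obtain ⟨u, hu, hug, hlim⟩ := exists_seq_tendsto_inner htot g
  refine (Lp.eLpNorm_lim_le_liminf_eLpNorm (fun n => (hk.memLp_inner_of_mem_span (hu n)).1) _
    (.of_forall hlim)).trans_eq ?_
  simp_rw [fun n => hk.eLpNorm_inner_of_mem_span (hu n)]
  exact hug.enorm.liminf_eq

lemma memLp_inner (hk : IsReproducingFamily 𝕜 μ k)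
    (htot : Dense (Submodule.span 𝕜 (Set.range k) : Set H)) (g : H) :
    MemLp (fun y => ⟪k y, g⟫_𝕜) 2 μ := by
  obtain ⟨u, hu, -, hlim⟩ := exists_seq_tendsto_inner htot g
  exact ⟨aestronglyMeasurable_of_tendsto_ae atTop
    (fun n => (hk.memLp_inner_of_mem_span (hu n)).1) (.of_forall hlim),
    (hk.eLpNorm_inner_le htot g).trans_lt enorm_lt_top⟩

/-- The transform `g ↦ ⟪k ·, g⟫` of a total reproducing family, as a bounded operator into
`L²(μ)`; `IsReproducingFamily.isometry` shows that it preserves the norm. -/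
noncomputable def transform (hk : IsReproducingFamily 𝕜 μ k)
    (htot : Dense (Submodule.span 𝕜 (Set.range k) : Set H)) : H →L[𝕜] Lp 𝕜 2 μ :=
  LinearMap.mkContinuous
    { toFun := fun g => (hk.memLp_inner htot g).toLp
      map_add' := fun g g' => by
        rw [← MemLp.toLp_add]
        exact MemLp.toLp_congr _ _ (.of_forall fun y => inner_add_right _ _ _)
      map_smul' := fun c g => by
        rw [RingHom.id_apply, ← MemLp.toLp_const_smul]
        exact MemLp.toLp_congr _ _ (.of_forall fun y => inner_smul_right _ _ _) }
    1 fun g => by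
      rw [LinearMap.coe_mk, AddHom.coe_mk, Lp.norm_toLp, one_mul, ← toReal_enorm g]
      exact ENNReal.toReal_mono enorm_ne_top (hk.eLpNorm_inner_le htot g)

lemma norm_transform (hk : IsReproducingFamily 𝕜 μ k)
    (htot : Dense (Submodule.span 𝕜 (Set.range k) : Set H)) (g : H) :
    ‖hk.transform htot g‖ = ‖g‖ := by
  have hspan : Set.EqOn (‖hk.transform htot ·‖) norm (Submodule.span 𝕜 (Set.range k)) :=
    fun g hg => (Lp.norm_toLp _ (hk.memLp_inner htot g)).trans <| by
      rw [hk.eLpNorm_inner_of_mem_span hg, toReal_enorm]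
  exact congrFun (Continuous.ext_on htot (by fun_prop) continuous_norm hspan) g

/-- The transform `g ↦ ⟪k ·, g⟫` of a total reproducing family, as an isometry into `L²(μ)`. -/
noncomputable def isometry (hk : IsReproducingFamily 𝕜 μ k)
    (htot : Dense (Submodule.span 𝕜 (Set.range k) : Set H)) : H →ₗᵢ[𝕜] Lp 𝕜 2 μ :=
  ⟨(hk.transform htot).toLinearMap, hk.norm_transform htot⟩

lemma coeFn_isometry (hk : IsReproducingFamily 𝕜 μ k)
    (htot : Dense (Submodule.span 𝕜 (Set.range k) : Set H)) (g : H) :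
    hk.isometry htot g =ᵐ[μ] fun y => ⟪k y, g⟫_𝕜 :=
  (hk.memLp_inner htot g).coeFn_toLp

end IsReproducingFamily

lemma inner_adjoint_toLp_eq [CompleteSpace H] {U : H →L[𝕜] Lp 𝕜 2 μ}
    (hU : ∀ g, U g =ᵐ[μ] fun y => ⟪k y, g⟫_𝕜) {F : X → 𝕜} (hF : MemLp F 2 μ) (g : H) :
    ⟪g, ContinuousLinearMap.adjoint U hF.toLp⟫_𝕜 = ∫ y, F y * conj ⟪k y, g⟫_𝕜 ∂μ := by
  rw [ContinuousLinearMap.adjoint_inner_right, L2.inner_def]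
  refine integral_congr_ae ?_
  filter_upwards [hF.coeFn_toLp, hU g] with y hFy hUy
  rw [hFy, hUy, RCLike.inner_apply]

end ReproducingKernel

section IntegralTransform

variable {𝕜 X Y : Type*} [RCLike 𝕜] [MeasurableSpace X] [MeasurableSpace Y] {μ : Measure X}
  {ν : Measure Y} {κ : X → Y → 𝕜} {E : Set X} {C : ℝ} {F : X → 𝕜}

lemma ae_norm_setIntegral_mul_le (hE : MeasurableSet E) (hμE : μ E ≠ ⊤)
    (hC : ∀ᵐ y ∂ν, ∀ x ∈ E, ‖κ x y‖ ≤ C) (hF : MemLp F 2 μ) :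
    ∀ᵐ y ∂ν, ‖∫ x in E, F x * κ x y ∂μ‖ ≤ ∫ x in E, ‖F x‖ * C ∂μ := by
  have : IsFiniteMeasure (μ.restrict E) := isFiniteMeasure_restrict.2 hμE
  filter_upwards [hC] with y hy
  refine norm_integral_le_of_norm_le (((hF.restrict E).integrable one_le_two).norm.mul_const C) ?_
  filter_upwards [ae_restrict_mem hE] with x hx
  rw [norm_mul]
  gcongr
  exact hy x hx

variable [IsFiniteMeasure ν]

lemma memLp_setIntegral_mul (hκ : Measurable (Function.uncurry κ)) (hE : MeasurableSet E)
    (hμE : μ E ≠ ⊤) (hC : ∀ᵐ y ∂ν, ∀ x ∈ E, ‖κ x y‖ ≤ C) (hF : MemLp F 2 μ) :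
    MemLp (fun y => ∫ x in E, F x * κ x y ∂μ) 2 ν := by
  have : IsFiniteMeasure (μ.restrict E) := isFiniteMeasure_restrict.2 hμE
  refine .of_bound ?_ _ (ae_norm_setIntegral_mul_le hE hμE hC hF)
  have hmeas : AEStronglyMeasurable (fun p : Y × X => F p.2 * κ p.2 p.1)
      (ν.prod (μ.restrict E)) :=
    (hF.restrict E).1.comp_snd.mul (hκ.comp measurable_swap).aestronglyMeasurable
  exact hmeas.integral_prod_right'

lemma integrable_prod_mul_mul (hκ : Measurable (Function.uncurry κ)) (hE : MeasurableSet E)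
    (hμE : μ E ≠ ⊤) (hC : ∀ᵐ y ∂ν, ∀ x ∈ E, ‖κ x y‖ ≤ C) (hF : MemLp F 2 μ) {g : Y → 𝕜}
    (hg : MemLp g 2 ν) :
    Integrable (fun p : X × Y => F p.1 * conj (g p.2) * κ p.1 p.2) ((μ.restrict E).prod ν) := by
  have : IsFiniteMeasure (μ.restrict E) := isFiniteMeasure_restrict.2 hμE
  refine (((hF.restrict E).integrable one_le_two).mul_prod
    (hg.star.integrable one_le_two)).mul_bdd (c := C) hκ.aestronglyMeasurable ?_
  filter_upwards [Measure.quasiMeasurePreserving_fst.ae (ae_restrict_mem hE),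
    Measure.quasiMeasurePreserving_snd.ae hC] with p hp₁ hp₂
  exact hp₂ _ hp₁

lemma toLp_setIntegral_mul_eq_adjoint (hκ : Measurable (Function.uncurry κ))
    (hE : MeasurableSet E) (hμE : μ E ≠ ⊤) (hC : ∀ᵐ y ∂ν, ∀ x ∈ E, ‖κ x y‖ ≤ C)
    (hF : MemLp F 2 μ) {U : Lp 𝕜 2 ν →L[𝕜] Lp 𝕜 2 μ}
    (hU : ∀ g, U g =ᵐ[μ] fun x => ∫ y, g y * conj (κ x y) ∂ν) :
    (memLp_setIntegral_mul hκ hE hμE hC hF).toLp =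
      ContinuousLinearMap.adjoint U (hF.indicator hE).toLp := by
  have : IsFiniteMeasure (μ.restrict E) := isFiniteMeasure_restrict.2 hμE
  refine ext_inner_left 𝕜 fun g => ?_
  calc ⟪g, (memLp_setIntegral_mul hκ hE hμE hC hF).toLp⟫_𝕜
    _ = ∫ y, ∫ x in E, F x * conj (g y) * κ x y ∂μ ∂ν := by
      rw [L2.inner_def]
      refine integral_congr_ae ?_
      filter_upwards [(memLp_setIntegral_mul hκ hE hμE hC hF).coeFn_toLp] with y hy
      rw [hy, RCLike.inner_apply, ← integral_mul_const]
      simp only [mul_right_comm]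
    _ = ∫ x in E, ∫ y, F x * conj (g y) * κ x y ∂ν ∂μ :=
      (integral_integral_swap (integrable_prod_mul_mul hκ hE hμE hC hF (Lp.memLp g))).symm
    _ = ∫ x, E.indicator F x * conj (∫ y, g y * conj (κ x y) ∂ν) ∂μ := by
      rw [← integral_indicator hE]
      congr with x
      by_cases hx : x ∈ E
      · simp only [hx, Set.indicator_of_mem, ← integral_conj, ← integral_const_mul, map_mul,
          RCLike.conj_conj, mul_assoc]
      · simp [hx]
    _ = ⟪U g, (hF.indicator hE).toLp⟫_𝕜 := by
      rw [L2.inner_def]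
      refine integral_congr_ae ?_
      filter_upwards [(hF.indicator hE).coeFn_toLp, hU g] with x hFx hUx
      rw [hFx, hUx, RCLike.inner_apply]
    _ = ⟪g, ContinuousLinearMap.adjoint U (hF.indicator hE).toLp⟫_𝕜 :=
      (ContinuousLinearMap.adjoint_inner_right U _ _).symm

end IntegralTransform

section LpTwo

variable {X E : Type*} [MeasurableSpace X] [NormedAddCommGroup E] {μ : Measure X} {f : X → E}

lemma norm_toLp_two_sq (hf : MemLp f 2 μ) : ‖hf.toLp‖ ^ 2 = ∫ x, ‖f x‖ ^ 2 ∂μ := by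
  have hint : 0 ≤ ∫ x, ‖f x‖ ^ 2 ∂μ := by positivity
  rw [Lp.norm_toLp, hf.eLpNorm_eq_integral_rpow_norm two_ne_zero ENNReal.ofNat_ne_top]
  simp only [ENNReal.toReal_ofNat, Real.rpow_ofNat, ← one_div, ← Real.sqrt_eq_rpow]
  rw [ENNReal.toReal_ofReal (Real.sqrt_nonneg _), Real.sq_sqrt hint]

lemma tendsto_toLp_indicator (hf : MemLp f 2 μ) {s : ℕ → Set X} (hs : ∀ n, MeasurableSet (s n))
    (hmono : Monotone s) (huniv : ⋃ n, s n = Set.univ) :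
    Tendsto (fun n => (hf.indicator (hs n)).toLp ((s n).indicator f)) atTop (𝓝 hf.toLp) := by
  have hnorm (n : ℕ) : ‖(hf.indicator (hs n)).toLp ((s n).indicator f) - hf.toLp‖ ^ 2 =
      ∫ x in (s n)ᶜ, ‖f x‖ ^ 2 ∂μ := by
    rw [← MemLp.toLp_sub, norm_toLp_two_sq, ← integral_indicator (hs n).compl]
    refine integral_congr_ae (.of_forall fun x => ?_)
    by_cases hx : x ∈ s n <;> simp [hx]
  have hlim : Tendsto (fun n => ∫ x in (s n)ᶜ, ‖f x‖ ^ 2 ∂μ) atTop (𝓝 0) := by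
    have := tendsto_setIntegral_of_antitone (μ := μ) (f := fun x => ‖f x‖ ^ 2)
      (fun n => (hs n).compl) (fun _ _ hmn => Set.compl_subset_compl.2 (hmono hmn))
      ⟨0, ((memLp_two_iff_integrable_sq_norm hf.1).1 hf).integrableOn⟩
    rwa [← Set.compl_iUnion, huniv, Set.compl_univ, setIntegral_empty] at this
  rw [tendsto_iff_norm_sub_tendsto_zero]
  simpa only [← hnorm, Real.sqrt_sq (norm_nonneg _), Real.sqrt_zero] using hlim.sqrt

end LpTwo

section HolomorphicChangeOfVariables

lemma det_restrictScalars_toSpanSingleton (c : ℂ) :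
    ((ContinuousLinearMap.toSpanSingleton ℂ c).restrictScalars ℝ).det = ‖c‖ ^ 2 := by
  have hmul : (ContinuousLinearMap.toSpanSingleton ℂ c : ℂ →ₗ[ℂ] ℂ) = LinearMap.mulLeft ℂ c := by
    ext; simp
  rw [ContinuousLinearMap.det]
  change LinearMap.det
    ((ContinuousLinearMap.toSpanSingleton ℂ c : ℂ →ₗ[ℂ] ℂ).restrictScalars ℝ) = _
  rw [hmul, LinearMap.det_restrictScalars, LinearMap.det_mulLeft, Algebra.norm_complex_eq]
  exact Complex.normSq_eq_norm_sq c

variable {E : Type*} [NormedAddCommGroup E] [NormedSpace ℝ E] {s : Set ℂ} {φ φ' : ℂ → ℂ}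

lemma integrableOn_image_iff_of_hasDerivAt (hs : MeasurableSet s)
    (hφ : ∀ z ∈ s, HasDerivAt φ (φ' z) z) (hinj : Set.InjOn φ s) (f : ℂ → E) :
    IntegrableOn f (φ '' s) ↔ IntegrableOn (fun z => ‖φ' z‖ ^ 2 • f (φ z)) s := by
  simpa [det_restrictScalars_toSpanSingleton] using
    integrableOn_image_iff_integrableOn_abs_det_fderiv_smul volume hs
      (fun z hz => ((hφ z hz).hasFDerivAt.restrictScalars ℝ).hasFDerivWithinAt) hinj f

lemma integral_image_eq_of_hasDerivAt (hs : MeasurableSet s)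
    (hφ : ∀ z ∈ s, HasDerivAt φ (φ' z) z) (hinj : Set.InjOn φ s) (f : ℂ → E) :
    ∫ z in φ '' s, f z = ∫ z in s, ‖φ' z‖ ^ 2 • f (φ z) := by
  simpa [det_restrictScalars_toSpanSingleton] using
    integral_image_eq_integral_abs_det_fderiv_smul volume hs
      (fun z hz => ((hφ z hz).hasFDerivAt.restrictScalars ℝ).hasFDerivWithinAt) hinj f

end HolomorphicChangeOfVariables

section RadialMeanValue

open Metric Real

lemma measurePreserving_circleMap_mul (θ : ℝ) :
    MeasurePreserving fun ζ : ℂ => circleMap 0 1 θ * ζ := by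
  have hrot : (fun ζ : ℂ => circleMap 0 1 θ * ζ) = rotation (Circle.exp θ) := by
    ext ζ; simp [circleMap]
  exact hrot ▸ (rotation (Circle.exp θ)).measurePreserving

lemma integral_circleAverage_comp_mul {E : Type*} [NormedAddCommGroup E] [NormedSpace ℝ E]
    [CompleteSpace E] {f : ℂ → E} (hf : Integrable f) :
    ∫ ζ, circleAverage (fun u => f (u * ζ)) 0 1 = ∫ ζ, f ζ := by
  have hskew : MeasurePreserving (fun p : ℝ × ℂ => (p.1, circleMap 0 1 p.1 * p.2))
      ((volume.restrict (Set.uIoc 0 (2 * π))).prod volume)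
      ((volume.restrict (Set.uIoc 0 (2 * π))).prod volume) :=
    (MeasurePreserving.id _).skew_product
      (((continuous_circleMap 0 1).comp continuous_fst).mul continuous_snd).measurable
      (.of_forall fun θ => (measurePreserving_circleMap_mul θ).map_eq)
  have : IsFiniteMeasure (volume.restrict (Set.uIoc 0 (2 * π))) := ⟨by simp [Set.uIoc]⟩
  have hint : Integrable (Function.uncurry fun θ ζ => f (circleMap 0 1 θ * ζ))
      ((volume.restrict (Set.uIoc 0 (2 * π))).prod volume) :=
    hskew.integrable_comp_of_integrable (hf.comp_snd _)
  have hinner (θ : ℝ) : ∫ ζ, f (circleMap 0 1 θ * ζ) = ∫ ζ, f ζ := by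
    have hne : circleMap 0 1 θ ≠ 0 := circleMap_ne_center one_ne_zero
    exact (measurePreserving_circleMap_mul θ).integral_comp
      (Homeomorph.mulLeft₀ _ hne).measurableEmbedding f
  have hswap := integral_integral_swap hint
  simp only [Set.uIoc_of_le two_pi_pos.le, ← intervalIntegral.integral_of_le two_pi_pos.le, hinner]
    at hswap
  simp only [circleAverage_def, integral_smul, ← hswap]
  rw [intervalIntegral.integral_const, sub_zero, inv_smul_smul₀ two_pi_pos.ne']

variable {E : Type*} [NormedAddCommGroup E] [NormedSpace ℂ E] [CompleteSpace E] {R : ℝ}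
  {G : ℂ → E}

lemma circleAverage_comp_mul_of_mem_ball (hG : DifferentiableOn ℂ G (ball 0 R)) {ζ : ℂ}
    (hζ : ζ ∈ ball 0 R) : circleAverage (fun u => G (u * ζ)) 0 1 = G 0 := by
  have hmaps : ∀ u ∈ closedBall (0 : ℂ) |1|, u * ζ ∈ ball (0 : ℂ) R := fun u hu => by
    rw [abs_one, mem_closedBall_zero_iff] at hu
    rw [mem_ball_zero_iff, norm_mul]
    exact (mul_le_of_le_one_left (norm_nonneg ζ) hu).trans_lt (mem_ball_zero_iff.1 hζ)
  have hdiff : DiffContOnCl ℂ (fun u => G (u * ζ)) (ball 0 |1|) :=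
    DifferentiableOn.diffContOnCl_ball (U := (· * ζ) ⁻¹' ball 0 R)
      (hG.comp (by fun_prop) fun u hu => hu) hmaps
  simpa only [zero_mul] using hdiff.circleAverage

lemma setIntegral_ball_radial_smul {w : ℝ → ℝ} (hG : DifferentiableOn ℂ G (ball 0 R))
    (hint : IntegrableOn (fun ζ => w ‖ζ‖ • G ζ) (ball 0 R)) :
    ∫ ζ in ball 0 R, w ‖ζ‖ • G ζ = (∫ ζ in ball (0 : ℂ) R, w ‖ζ‖) • G 0 := by
  have hmean (ζ : ℂ) : circleAverage
      (fun u => (ball 0 R).indicator (fun ζ => w ‖ζ‖ • G ζ) (u * ζ)) 0 1 =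
        (ball 0 R).indicator (fun ζ => w ‖ζ‖ • G 0) ζ := by
    have hnorm {u : ℂ} (hu : u ∈ sphere 0 |1|) : ‖u * ζ‖ = ‖ζ‖ := by
      rw [norm_mul, mem_sphere_zero_iff_norm.1 hu, abs_one, one_mul]
    by_cases hζ : ζ ∈ ball 0 R
    · rw [Set.indicator_of_mem hζ, ← circleAverage_comp_mul_of_mem_ball hG hζ,
        ← circleAverage_fun_smul]
      refine circleAverage_congr_sphere fun u hu => ?_
      have huζ : u * ζ ∈ ball 0 R := by simpa only [mem_ball_zero_iff, hnorm hu] using hζ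
      simp only [Set.indicator_of_mem huζ, hnorm hu]
    · rw [Set.indicator_of_notMem hζ, ← circleAverage_const (0 : E) 0 1]
      refine circleAverage_congr_sphere fun u hu => ?_
      have huζ : u * ζ ∉ ball 0 R := by simpa only [mem_ball_zero_iff, hnorm hu] using hζ
      exact Set.indicator_of_notMem huζ _
  rw [← integral_indicator measurableSet_ball,
    ← integral_circleAverage_comp_mul ((integrable_indicator_iff measurableSet_ball).2 hint),
    ← integral_smul_const, ← integral_indicator measurableSet_ball]
  simp only [hmean]

end RadialMeanValue

section UnitDisc

lemma one_sub_ne_zero_of_mem_ball {ζ : ℂ} (hζ : ζ ∈ Metric.ball (0 : ℂ) 1) : 1 - ζ ≠ 0 := by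
  rintro h
  rw [mem_ball_zero_iff, ← sub_eq_zero.1 h, norm_one] at hζ
  exact lt_irrefl _ hζ

lemma one_sub_re_pos_of_mem_ball {ζ : ℂ} (hζ : ζ ∈ Metric.ball (0 : ℂ) 1) : 0 < (1 - ζ).re := by
  rw [mem_ball_zero_iff] at hζ
  simpa only [Complex.sub_re, Complex.one_re, sub_pos] using (Complex.re_le_norm ζ).trans_lt hζ

lemma one_sub_norm_sq_pos_of_mem_ball {ζ : ℂ} (hζ : ζ ∈ Metric.ball (0 : ℂ) 1) :
    0 < 1 - ‖ζ‖ ^ 2 := by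
  rw [mem_ball_zero_iff] at hζ
  nlinarith [norm_nonneg ζ]

variable {α : ℝ}

lemma hasDerivAt_neg_one_sub_sq_rpow_div (hα : α ≠ 0) {r : ℝ} (hr : r ∈ Set.Ioo (0 : ℝ) 1) :
    HasDerivAt (fun r : ℝ => -(1 - r ^ 2) ^ α / (2 * α)) (r * (1 - r ^ 2) ^ (α - 1)) r := by
  have hpos : 0 < 1 - r ^ 2 := by nlinarith [hr.1, hr.2]
  have hsq : HasDerivAt (fun r : ℝ => 1 - r ^ 2) (-(2 * r)) r := by
    simpa using ((hasDerivAt_id r).pow 2).const_sub 1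
  convert! ((hsq.rpow_const (p := α) (.inl hpos.ne')).neg).div_const (2 * α) using 1
  field_simp

lemma continuous_neg_one_sub_sq_rpow_div (hα : 0 < α) :
    Continuous fun r : ℝ => -(1 - r ^ 2) ^ α / (2 * α) :=
  ((Continuous.rpow_const (by fun_prop) fun _ => .inr hα.le).neg).div_const _

lemma integrableOn_mul_one_sub_sq_rpow (hα : 0 < α) :
    IntegrableOn (fun r : ℝ => r * (1 - r ^ 2) ^ (α - 1)) (Set.Ioc 0 1) :=
  intervalIntegral.integrableOn_deriv_of_nonneg
    (continuous_neg_one_sub_sq_rpow_div hα).continuousOn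
    (fun _ hr => hasDerivAt_neg_one_sub_sq_rpow_div hα.ne' hr) fun r hr =>
      mul_nonneg hr.1.le (Real.rpow_nonneg (by nlinarith [hr.1, hr.2]) _)

lemma integral_mul_one_sub_sq_rpow (hα : 0 < α) :
    ∫ r in (0 : ℝ)..1, r * (1 - r ^ 2) ^ (α - 1) = 1 / (2 * α) := by
  rw [intervalIntegral.integral_eq_sub_of_hasDerivAt_of_le zero_le_one
    (continuous_neg_one_sub_sq_rpow_div hα).continuousOn
    (fun _ hr => hasDerivAt_neg_one_sub_sq_rpow_div hα.ne' hr)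
    ((intervalIntegrable_iff_integrableOn_Ioc_of_le zero_le_one).2
      (integrableOn_mul_one_sub_sq_rpow hα))]
  norm_num [Real.zero_rpow hα.ne', neg_div]

lemma indicator_ball_comp_norm (f : ℝ → ℝ) :
    (Metric.ball (0 : ℂ) 1).indicator (fun ζ => f ‖ζ‖) = fun ζ => (Set.Iio 1).indicator f ‖ζ‖ := by
  ext ζ
  by_cases hζ : ‖ζ‖ < 1 <;> simp [hζ]

lemma integrableOn_ball_comp_norm_iff (f : ℝ → ℝ) :
    IntegrableOn (fun ζ : ℂ => f ‖ζ‖) (Metric.ball 0 1) ↔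
      IntegrableOn (fun r => r * f r) (Set.Ioo 0 1) := by
  have hmul : (Set.Iio 1).indicator (fun r => r * f r) =
      fun r => r * (Set.Iio 1).indicator f r :=
    funext fun r => Set.indicator_mul_right (Set.Iio 1) id f
  rw [← integrable_indicator_iff measurableSet_ball, indicator_ball_comp_norm,
    integrable_fun_norm_addHaar (volume : Measure ℂ), ← Set.Ioi_inter_Iio, Set.inter_comm,
    ← integrableOn_indicator_iff measurableSet_Iio, hmul]
  simp only [Complex.finrank_real_complex, smul_eq_mul, Nat.add_one_sub_one, pow_one]

lemma setIntegral_ball_comp_norm (f : ℝ → ℝ) :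
    ∫ ζ in Metric.ball (0 : ℂ) 1, f ‖ζ‖ = 2 * Real.pi * ∫ r in (0 : ℝ)..1, r * f r := by
  rw [← integral_indicator measurableSet_ball, indicator_ball_comp_norm,
    integral_fun_norm_addHaar (volume : Measure ℂ), intervalIntegral.integral_of_le zero_le_one,
    integral_Ioc_eq_integral_Ioo, ← Set.Ioi_inter_Iio, ← setIntegral_indicator measurableSet_Iio]
  simp only [Complex.finrank_real_complex, smul_eq_mul, Nat.add_one_sub_one, pow_one,
    Set.indicator_mul_right, nsmul_eq_mul, Measure.real, Complex.volume_ball]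
  simp [mul_assoc]

lemma integrableOn_ball_one_sub_norm_sq_rpow (hα : 0 < α) :
    IntegrableOn (fun ζ : ℂ => (1 - ‖ζ‖ ^ 2) ^ (α - 1)) (Metric.ball 0 1) :=
  (integrableOn_ball_comp_norm_iff fun r => (1 - r ^ 2) ^ (α - 1)).2
    ((integrableOn_mul_one_sub_sq_rpow hα).mono_set Set.Ioo_subset_Ioc_self)

lemma integral_ball_one_sub_norm_sq_rpow (hα : 0 < α) :
    ∫ ζ in Metric.ball (0 : ℂ) 1, (1 - ‖ζ‖ ^ 2) ^ (α - 1) = Real.pi / α := by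
  rw [setIntegral_ball_comp_norm fun r => (1 - r ^ 2) ^ (α - 1), integral_mul_one_sub_sq_rpow hα]
  field_simp

end UnitDisc

/-- The Cayley transform from the unit disc onto the right half-plane that sends `0` to `w₀`. -/
noncomputable def cayley (w₀ ζ : ℂ) : ℂ := (w₀ + conj w₀ * ζ) / (1 - ζ)

section Cayley

variable {w₀ w ζ : ℂ}

lemma cayley_zero : cayley w₀ 0 = w₀ := by simp [cayley]

lemma cayley_add_conj (hζ : 1 - ζ ≠ 0) :
    cayley w₀ ζ + conj w₀ = ((2 * w₀.re : ℝ) : ℂ) * (1 - ζ)⁻¹ := by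
  rw [cayley, ← Complex.add_conj w₀]
  field_simp
  ring

lemma re_cayley (w₀ ζ : ℂ) : (cayley w₀ ζ).re = w₀.re * (1 - ‖ζ‖ ^ 2) / ‖1 - ζ‖ ^ 2 := by
  rw [cayley, Complex.div_re, ← add_div, ← Complex.normSq_eq_norm_sq, ← Complex.normSq_eq_norm_sq]
  congr 1
  simp only [Complex.normSq_apply, Complex.add_re, Complex.mul_re, Complex.conj_re,
    Complex.conj_im, Complex.sub_re, Complex.one_re, Complex.add_im, Complex.mul_im,
    Complex.sub_im, Complex.one_im]
  ring

lemma hasDerivAt_cayley (hζ : 1 - ζ ≠ 0) :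
    HasDerivAt (cayley w₀) (((2 * w₀.re : ℝ) : ℂ) / (1 - ζ) ^ 2) ζ := by
  have hnum : HasDerivAt (fun ζ => w₀ + conj w₀ * ζ) (conj w₀) ζ := by
    simpa using ((hasDerivAt_id ζ).const_mul (conj w₀)).const_add w₀
  have hden : HasDerivAt (fun ζ : ℂ => 1 - ζ) (-1) ζ := by
    simpa using (hasDerivAt_id ζ).const_sub 1
  convert! hnum.div hden hζ using 1
  rw [← Complex.add_conj w₀]
  ring

lemma add_conj_ne_zero (hw₀ : 0 < w₀.re) (hw : 0 < w.re) : w + conj w₀ ≠ 0 := fun h => by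
  have hre : w.re + w₀.re = 0 := by simpa using congrArg Complex.re h
  linarith

lemma injOn_cayley (hw₀ : 0 < w₀.re) : Set.InjOn (cayley w₀) (Metric.ball 0 1) := by
  intro ζ hζ ξ hξ h
  have hinv := cayley_add_conj (w₀ := w₀) (one_sub_ne_zero_of_mem_ball hζ)
  rw [h, cayley_add_conj (one_sub_ne_zero_of_mem_ball hξ)] at hinv
  have hre : ((2 * w₀.re : ℝ) : ℂ) ≠ 0 := Complex.ofReal_ne_zero.2 (by positivity)
  exact (sub_right_injective (inv_injective (mul_left_cancel₀ hre hinv))).symm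

lemma div_add_conj_mem_ball (hw₀ : 0 < w₀.re) (hw : 0 < w.re) :
    (w - w₀) / (w + conj w₀) ∈ Metric.ball (0 : ℂ) 1 := by
  rw [mem_ball_zero_iff, norm_div, div_lt_one (norm_pos_iff.2 (add_conj_ne_zero hw₀ hw))]
  refine lt_of_pow_lt_pow_left₀ 2 (norm_nonneg _) ?_
  simp only [← Complex.normSq_eq_norm_sq, Complex.normSq_apply, Complex.sub_re, Complex.sub_im,
    Complex.add_re, Complex.add_im, Complex.conj_re, Complex.conj_im]
  nlinarith [mul_pos hw hw₀]

lemma cayley_div_add_conj (hw₀ : 0 < w₀.re) (hw : 0 < w.re) :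
    cayley w₀ ((w - w₀) / (w + conj w₀)) = w := by
  have hne := add_conj_ne_zero hw₀ hw
  have hre : ((2 * w₀.re : ℝ) : ℂ) ≠ 0 := Complex.ofReal_ne_zero.2 (by positivity)
  have hsub : 1 - (w - w₀) / (w + conj w₀) = ((2 * w₀.re : ℝ) : ℂ) / (w + conj w₀) := by
    rw [← Complex.add_conj w₀]
    field_simp
    ring
  have hadd := cayley_add_conj (w₀ := w₀)
    (one_sub_ne_zero_of_mem_ball (div_add_conj_mem_ball hw₀ hw))
  rw [hsub, inv_div, mul_div_cancel₀ _ hre] at hadd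
  exact add_right_cancel hadd

lemma image_cayley (hw₀ : 0 < w₀.re) : cayley w₀ '' Metric.ball 0 1 = {w | 0 < w.re} := by
  refine Set.Subset.antisymm (Set.image_subset_iff.2 fun ζ hζ => ?_) fun w hw =>
    ⟨_, div_add_conj_mem_ball hw₀ hw, cayley_div_add_conj hw₀ hw⟩
  have hnum := one_sub_norm_sq_pos_of_mem_ball hζ
  have hden : 0 < ‖1 - ζ‖ := norm_pos_iff.2 (one_sub_ne_zero_of_mem_ball hζ)
  rw [Set.mem_preimage, Set.mem_ofPred_eq, re_cayley]
  positivity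

end Cayley

lemma ofReal_mul_cpow {r : ℝ} (hr : 0 < r) {u : ℂ} (hu : u ≠ 0) (p : ℂ) :
    ((r : ℂ) * u) ^ p = (r : ℂ) ^ p * u ^ p := by
  have hr0 : (r : ℂ) ≠ 0 := Complex.ofReal_ne_zero.2 hr.ne'
  rw [Complex.cpow_def_of_ne_zero (mul_ne_zero hr0 hu), Complex.cpow_def_of_ne_zero hr0,
    Complex.cpow_def_of_ne_zero hu, Complex.log_ofReal_mul hr hu, ← Complex.exp_add,
    ← Complex.ofReal_log hr.le, add_mul]

section HalfPlane

variable {α : ℝ} {w₀ ζ : ℂ} {f : ℂ → ℂ}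

/-- The pull-back `ζ ↦ f (cayley w₀ ζ) (1 - ζ) ^ (-(α + 1))` of a function on the right half-plane
to the unit disc. Up to a constant it maps `L²((Re w) ^ (α - 1) dA)` isometrically onto
`L²((1 - |ζ|²) ^ (α - 1) dA)`. -/
noncomputable def discPullback (α : ℝ) (w₀ : ℂ) (f : ℂ → ℂ) (ζ : ℂ) : ℂ :=
  f (cayley w₀ ζ) * ((1 - ζ) ^ ((α + 1 : ℝ) : ℂ))⁻¹

/-- Up to a constant, the reproducing kernel at `w₀` of the Bergman space of the right half-plane
with weight `(Re w) ^ (α - 1)`. -/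
noncomputable def halfPlaneKernel (α : ℝ) (w₀ w : ℂ) : ℂ := (w + conj w₀) ^ ((-(α + 1) : ℝ) : ℂ)

lemma discPullback_zero : discPullback α w₀ f 0 = f w₀ := by simp [discPullback, cayley_zero]

lemma discPullback_halfPlaneKernel (hw₀ : 0 < w₀.re) (hζ : ζ ∈ Metric.ball (0 : ℂ) 1) :
    discPullback α w₀ (halfPlaneKernel α w₀) ζ = ((2 * w₀.re) ^ (-(α + 1)) : ℝ) := by
  have hre : 0 < 2 * w₀.re := by positivity
  have hζ0 := one_sub_ne_zero_of_mem_ball hζ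
  have harg : (1 - ζ).arg ≠ Real.pi := fun h =>
    (one_sub_re_pos_of_mem_ball hζ).not_gt (Complex.arg_eq_pi_iff.1 h).1
  rw [discPullback, halfPlaneKernel, cayley_add_conj hζ0,
    ofReal_mul_cpow hre (inv_ne_zero hζ0), Complex.inv_cpow _ _ harg, Complex.ofReal_cpow hre.le,
    Complex.ofReal_neg, Complex.cpow_neg (1 - ζ), inv_inv,
    mul_inv_cancel_right₀ (Complex.cpow_ne_zero_iff.2 (.inl hζ0))]

lemma differentiableOn_discPullback (hw₀ : 0 < w₀.re)
    (hf : DifferentiableOn ℂ f {w | 0 < w.re}) :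
    DifferentiableOn ℂ (discPullback α w₀ f) (Metric.ball 0 1) := by
  have hcayley : DifferentiableOn ℂ (cayley w₀) (Metric.ball 0 1) := fun ζ hζ =>
    (hasDerivAt_cayley (one_sub_ne_zero_of_mem_ball hζ)).differentiableAt.differentiableWithinAt
  have hmaps : Set.MapsTo (cayley w₀) (Metric.ball 0 1) {w | 0 < w.re} :=
    Set.mapsTo_iff_image_subset.2 (image_cayley hw₀).subset
  refine (hf.comp hcayley hmaps).mul (DifferentiableOn.inv ?_ fun ζ hζ =>
    Complex.cpow_ne_zero_iff.2 (.inl (one_sub_ne_zero_of_mem_ball hζ)))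
  exact DifferentiableOn.cpow (by fun_prop) (by fun_prop) fun ζ hζ =>
    .inl (one_sub_re_pos_of_mem_ball hζ)

lemma norm_deriv_cayley_sq_mul_re_rpow (hw₀ : 0 < w₀.re) (hζ : ζ ∈ Metric.ball (0 : ℂ) 1) :
    ‖((2 * w₀.re : ℝ) : ℂ) / (1 - ζ) ^ 2‖ ^ 2 * (cayley w₀ ζ).re ^ (α - 1) =
      4 * w₀.re ^ (α + 1) *
        ((‖(1 - ζ) ^ ((α + 1 : ℝ) : ℂ)‖ ^ 2)⁻¹ * (1 - ‖ζ‖ ^ 2) ^ (α - 1)) := by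
  have hd : 0 < ‖1 - ζ‖ := norm_pos_iff.2 (one_sub_ne_zero_of_mem_ball hζ)
  have hb := one_sub_norm_sq_pos_of_mem_ball hζ
  have hpow : ‖1 - ζ‖ ^ (α + 1) = ‖1 - ζ‖ ^ (α - 1) * ‖1 - ζ‖ ^ 2 := by
    rw [← Real.rpow_natCast, ← Real.rpow_add hd]
    congr 1
    push_cast
    ring
  have hpow' : w₀.re ^ (α + 1) = w₀.re ^ (α - 1) * w₀.re ^ 2 := by
    rw [← Real.rpow_natCast, ← Real.rpow_add hw₀]
    congr 1
    push_cast
    ring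
  have hsq : (‖1 - ζ‖ ^ 2) ^ (α - 1) = (‖1 - ζ‖ ^ (α - 1)) ^ 2 := by
    rw [← Real.rpow_natCast, ← Real.rpow_natCast, ← Real.rpow_mul hd.le, ← Real.rpow_mul hd.le,
      mul_comm]
  rw [re_cayley, norm_div, norm_pow, Complex.norm_real, Real.norm_of_nonneg (by positivity),
    Complex.norm_cpow_real, Real.div_rpow (by positivity) (by positivity),
    Real.mul_rpow hw₀.le hb.le, hsq, hpow, hpow']
  field_simp
  norm_num

lemma integrableOn_halfPlane_iff (hw₀ : 0 < w₀.re) (f : ℂ → ℂ) :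
    IntegrableOn (fun w => ‖f w‖ ^ 2 * w.re ^ (α - 1)) {w | 0 < w.re} ↔
      IntegrableOn (fun ζ => ‖discPullback α w₀ f ζ‖ ^ 2 * (1 - ‖ζ‖ ^ 2) ^ (α - 1))
        (Metric.ball 0 1) := by
  rw [← image_cayley hw₀, integrableOn_image_iff_of_hasDerivAt measurableSet_ball
    (fun ζ hζ => hasDerivAt_cayley (one_sub_ne_zero_of_mem_ball hζ)) (injOn_cayley hw₀)]
  have hconst : IsUnit (4 * w₀.re ^ (α + 1)) := isUnit_iff_ne_zero.2 (by positivity)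
  refine (integrableOn_congr_fun (fun ζ hζ => ?_) measurableSet_ball).trans
    (integrable_const_mul_iff hconst _)
  rw [smul_eq_mul, mul_left_comm, norm_deriv_cayley_sq_mul_re_rpow hw₀ hζ, discPullback, norm_mul,
    norm_inv]
  ring

lemma setIntegral_halfPlane_eq (hw₀ : 0 < w₀.re) (f h : ℂ → ℂ) :
    ∫ w in {w : ℂ | 0 < w.re}, w.re ^ (α - 1) • (f w * conj (h w)) =
      (4 * w₀.re ^ (α + 1)) • ∫ ζ in Metric.ball 0 1, (1 - ‖ζ‖ ^ 2) ^ (α - 1) •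
        (discPullback α w₀ f ζ * conj (discPullback α w₀ h ζ)) := by
  rw [← image_cayley hw₀, integral_image_eq_of_hasDerivAt measurableSet_ball
    (fun ζ hζ => hasDerivAt_cayley (one_sub_ne_zero_of_mem_ball hζ)) (injOn_cayley hw₀),
    ← integral_smul]
  refine setIntegral_congr_fun measurableSet_ball fun ζ hζ => ?_
  rw [smul_smul, norm_deriv_cayley_sq_mul_re_rpow hw₀ hζ, discPullback, discPullback, map_mul,
    map_inv₀, mul_mul_mul_comm (f _), ← mul_inv, Complex.mul_conj, Complex.normSq_eq_norm_sq]
  simp only [Complex.real_smul, Complex.ofReal_mul, Complex.ofReal_inv]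
  ring

lemma integrableOn_halfPlaneKernel (hα : 0 < α) (hw₀ : 0 < w₀.re) :
    IntegrableOn (fun w => ‖halfPlaneKernel α w₀ w‖ ^ 2 * w.re ^ (α - 1)) {w | 0 < w.re} := by
  rw [integrableOn_halfPlane_iff hw₀]
  refine (integrableOn_congr_fun (fun ζ hζ => ?_) measurableSet_ball).2 <|
    (integrableOn_ball_one_sub_norm_sq_rpow hα).const_mul
      (‖(((2 * w₀.re) ^ (-(α + 1)) : ℝ) : ℂ)‖ ^ 2)
  rw [discPullback_halfPlaneKernel hw₀ hζ]

lemma integrableOn_ball_rpow_smul {G : ℂ → ℂ} (hα : 0 < α)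
    (hG : ContinuousOn G (Metric.ball 0 1))
    (hint : IntegrableOn (fun ζ => ‖G ζ‖ ^ 2 * (1 - ‖ζ‖ ^ 2) ^ (α - 1)) (Metric.ball 0 1)) :
    IntegrableOn (fun ζ => (1 - ‖ζ‖ ^ 2) ^ (α - 1) • G ζ) (Metric.ball 0 1) := by
  refine (hint.add (integrableOn_ball_one_sub_norm_sq_rpow hα)).mono' ?_ ?_
  · have hmeas : Measurable fun ζ : ℂ => (1 - ‖ζ‖ ^ 2) ^ (α - 1) := by fun_prop
    exact hmeas.aestronglyMeasurable.smul (hG.aestronglyMeasurable measurableSet_ball)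
  · refine (ae_restrict_iff' measurableSet_ball).2 (.of_forall fun ζ hζ => ?_)
    have hw : 0 ≤ (1 - ‖ζ‖ ^ 2) ^ (α - 1) :=
      Real.rpow_nonneg (one_sub_norm_sq_pos_of_mem_ball hζ).le _
    have hamgm : ‖G ζ‖ ≤ ‖G ζ‖ ^ 2 + 1 := by nlinarith [sq_nonneg (‖G ζ‖ - 1)]
    rw [norm_smul, Real.norm_of_nonneg hw, Pi.add_apply]
    linarith [mul_le_mul_of_nonneg_left hamgm hw]

lemma setIntegral_halfPlane_mul_conj_halfPlaneKernel (hα : 0 < α)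
    (hf : DifferentiableOn ℂ f {w | 0 < w.re})
    (hint : IntegrableOn (fun w => ‖f w‖ ^ 2 * w.re ^ (α - 1)) {w | 0 < w.re}) (hw₀ : 0 < w₀.re) :
    ∫ w in {w : ℂ | 0 < w.re}, w.re ^ (α - 1) • (f w * conj (halfPlaneKernel α w₀ w)) =
      (Real.pi * 2 ^ (1 - α) / α) • f w₀ := by
  have hdiff := differentiableOn_discPullback (α := α) hw₀ hf
  have hconst : 4 * w₀.re ^ (α + 1) * (2 * w₀.re) ^ (-(α + 1)) = 2 ^ (1 - α) := by
    rw [Real.mul_rpow two_pos.le hw₀.le, Real.rpow_neg hw₀.le,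
      show 1 - α = -(α + 1) + 2 by ring, Real.rpow_add two_pos]
    field_simp
    norm_num
  calc
    _ = (4 * w₀.re ^ (α + 1)) • ∫ ζ in Metric.ball 0 1, (2 * w₀.re) ^ (-(α + 1)) •
          (1 - ‖ζ‖ ^ 2) ^ (α - 1) • discPullback α w₀ f ζ := by
      rw [setIntegral_halfPlane_eq hw₀]
      congr 1
      refine setIntegral_congr_fun measurableSet_ball fun ζ hζ => ?_
      simp only [discPullback_halfPlaneKernel hw₀ hζ, Complex.conj_ofReal, Complex.real_smul]
      ring
    _ = (2 : ℝ) ^ (1 - α) • (Real.pi / α) • f w₀ := by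
      rw [integral_smul, smul_smul, hconst, setIntegral_ball_radial_smul
        (w := fun r => (1 - r ^ 2) ^ (α - 1)) hdiff
        (integrableOn_ball_rpow_smul hα hdiff.continuousOn
          ((integrableOn_halfPlane_iff hw₀ f).1 hint)),
        integral_ball_one_sub_norm_sq_rpow hα, discPullback_zero]
    _ = _ := by
      rw [smul_smul]
      congr 1
      ring

end HalfPlane

section Sector

variable {α : ℝ} {z w : ℂ}

lemma re_pos_of_mem_sector (hα2 : α ≤ 2) (hz : z ∈ sector α) : 0 < z.re :=
  (Complex.abs_arg_lt_pi_div_two_iff.1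
    (hz.2.trans_le (by nlinarith [Real.pi_pos]))).resolve_right hz.1

lemma mem_slitPlane_of_mem_sector (hα2 : α ≤ 2) (hz : z ∈ sector α) : z ∈ Complex.slitPlane :=
  .inl (re_pos_of_mem_sector hα2 hz)

lemma isOpen_sector (hα2 : α ≤ 2) : IsOpen (sector α) := by
  have hsector : sector α = Complex.slitPlane ∩ Complex.arg ⁻¹' {θ | |θ| < Real.pi * α / 4} :=
    Set.Subset.antisymm (fun z hz => ⟨mem_slitPlane_of_mem_sector hα2 hz, hz.2⟩)
      fun z hz => ⟨Complex.slitPlane_ne_zero hz.1, hz.2⟩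
  rw [hsector]
  exact ContinuousOn.isOpen_inter_preimage
    (fun z hz => (Complex.continuousAt_arg hz).continuousWithinAt) Complex.isOpen_slitPlane
    (isOpen_lt continuous_abs continuous_const)

lemma arg_cpow_ofReal (hz : z ≠ 0) {p : ℝ} (hp : |p * z.arg| < Real.pi) :
    (z ^ (p : ℂ)).arg = p * z.arg := by
  have him : (Complex.log z * p).im = p * z.arg := by rw [Complex.im_mul_ofReal, Complex.log_im,
    mul_comm]
  rw [← Complex.log_im, Complex.cpow_def_of_ne_zero hz, Complex.log_exp, him]
  · exact him ▸ (abs_lt.1 hp).1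
  · exact him ▸ (abs_lt.1 hp).2.le

lemma cpow_ofReal_cpow_ofReal_of_mul_eq_one {p q : ℝ} (hp : |p * z.arg| < Real.pi)
    (hpq : p * q = 1) : (z ^ (p : ℂ)) ^ (q : ℂ) = z := by
  have him : (Complex.log z * p).im = p * z.arg := by rw [Complex.im_mul_ofReal, Complex.log_im,
    mul_comm]
  rw [← Complex.cpow_mul _ (him ▸ (abs_lt.1 hp).1) (him ▸ (abs_lt.1 hp).2.le),
    ← Complex.ofReal_mul, hpq, Complex.ofReal_one, Complex.cpow_one]

lemma abs_two_div_mul_arg_lt (hα : 0 < α) (hz : z ∈ sector α) :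
    |2 / α * z.arg| < Real.pi / 2 := by
  rw [abs_mul, abs_of_pos (by positivity)]
  calc 2 / α * |z.arg| < 2 / α * (Real.pi * α / 4) := by gcongr; exact hz.2
    _ = Real.pi / 2 := by field_simp; norm_num

lemma abs_half_mul_arg_lt (hα : 0 < α) (hw : 0 < w.re) : |α / 2 * w.arg| < Real.pi * α / 4 := by
  rw [abs_mul, abs_of_pos (by positivity)]
  calc α / 2 * |w.arg| < α / 2 * (Real.pi / 2) := by
        gcongr
        exact Complex.abs_arg_lt_pi_div_two_iff.2 (.inl hw)
    _ = Real.pi * α / 4 := by ring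

lemma abs_half_mul_arg_lt_pi (hα : 0 < α) (hα2 : α ≤ 2) (hw : 0 < w.re) :
    |α / 2 * w.arg| < Real.pi :=
  (abs_half_mul_arg_lt hα hw).trans_le (by nlinarith [Real.pi_pos])

lemma cpow_half_cpow_two_div (hα : 0 < α) (hα2 : α ≤ 2) (hw : 0 < w.re) :
    (w ^ ((α / 2 : ℝ) : ℂ)) ^ ((2 / α : ℝ) : ℂ) = w :=
  cpow_ofReal_cpow_ofReal_of_mul_eq_one (abs_half_mul_arg_lt_pi hα hα2 hw) (by field_simp)

lemma cpow_two_div_cpow_half (hα : 0 < α) (hz : z ∈ sector α) :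
    (z ^ ((2 / α : ℝ) : ℂ)) ^ ((α / 2 : ℝ) : ℂ) = z :=
  cpow_ofReal_cpow_ofReal_of_mul_eq_one
    ((abs_two_div_mul_arg_lt hα hz).trans (half_lt_self Real.pi_pos)) (by field_simp)

lemma rePow_pos (hα : 0 < α) (hz : z ∈ sector α) : 0 < rePow α z := by
  have harg := abs_two_div_mul_arg_lt hα hz
  rw [← arg_cpow_ofReal hz.1 (harg.trans (half_lt_self Real.pi_pos))] at harg
  exact (Complex.abs_arg_lt_pi_div_two_iff.1 harg).resolve_right
    (Complex.cpow_ne_zero_iff.2 (.inl hz.1))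

lemma rePow_cpow_half (hα : 0 < α) (hα2 : α ≤ 2) (hw : 0 < w.re) :
    rePow α (w ^ ((α / 2 : ℝ) : ℂ)) = w.re := by
  rw [rePow, cpow_half_cpow_two_div hα hα2 hw]

lemma ne_zero_of_re_pos (hw : 0 < w.re) : w ≠ 0 := by
  rintro rfl
  exact lt_irrefl _ hw

lemma cpow_half_mem_sector (hα : 0 < α) (hα2 : α ≤ 2) (hw : 0 < w.re) :
    w ^ ((α / 2 : ℝ) : ℂ) ∈ sector α := by
  refine ⟨Complex.cpow_ne_zero_iff.2 (.inl (ne_zero_of_re_pos hw)), ?_⟩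
  rw [arg_cpow_ofReal (ne_zero_of_re_pos hw) (abs_half_mul_arg_lt_pi hα hα2 hw)]
  exact abs_half_mul_arg_lt hα hw

lemma bijOn_cpow_half (hα : 0 < α) (hα2 : α ≤ 2) :
    Set.BijOn (fun w : ℂ => w ^ ((α / 2 : ℝ) : ℂ)) {w | 0 < w.re} (sector α) :=
  Set.InvOn.bijOn (f' := fun z : ℂ => z ^ ((2 / α : ℝ) : ℂ))
    ⟨fun _ hw => cpow_half_cpow_two_div hα hα2 hw, fun _ hz => cpow_two_div_cpow_half hα hz⟩
    (fun _ hw => cpow_half_mem_sector hα hα2 hw) fun _ hz => rePow_pos hα hz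

lemma hasDerivAt_cpow_half (α : ℝ) (hw : 0 < w.re) :
    HasDerivAt (fun w : ℂ => w ^ ((α / 2 : ℝ) : ℂ))
      (((α / 2 : ℝ) : ℂ) * w ^ ((α / 2 - 1 : ℝ) : ℂ)) w := by
  simpa using (hasDerivAt_id w).cpow_const (c := ((α / 2 : ℝ) : ℂ)) (.inl hw)

lemma differentiableOn_cpow_sector (hα2 : α ≤ 2) (p : ℂ) :
    DifferentiableOn ℂ (fun z : ℂ => z ^ p) (sector α) := fun _ hz =>
  (differentiableAt_id.cpow (differentiableAt_const _)
    (mem_slitPlane_of_mem_sector hα2 hz)).differentiableWithinAt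

end Sector

section SectorMeasure

variable {α t : ℝ} {w : ℂ}

/-- The constant `π⁻¹ 2 ^ (α - 1) B(α/2, α/2)` of `sectorMeasure`. -/
noncomputable def densityConst (α : ℝ) : ℝ :=
  Real.pi⁻¹ * 2 ^ (α - 1) * ProbabilityTheory.beta (α / 2) (α / 2)

lemma densityConst_pos (hα : 0 < α) : 0 < densityConst α := by
  have hbeta : 0 < ProbabilityTheory.beta (α / 2) (α / 2) :=
    ProbabilityTheory.beta_pos (by positivity) (by positivity)
  unfold densityConst
  positivity

/-- The density of `sectorMeasure` with respect to the area measure. -/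
noncomputable def sectorDensity (α t : ℝ) (z : ℂ) : ℝ :=
  densityConst α * ‖z‖ ^ (4 * (1 - α) / α) * Real.exp (α ^ 2 / (2 * t) * rePow α z) *
    rePow α z ^ (α - 1)

lemma measurable_sectorDensity (α t : ℝ) : Measurable (sectorDensity α t) := by
  have hrePow := measurable_rePow α
  unfold sectorDensity
  fun_prop

lemma sectorDensity_pos (hα : 0 < α) {z : ℂ} (hz : z ∈ sector α) : 0 < sectorDensity α t z := by
  have hrePow := rePow_pos hα hz
  have hnorm := norm_pos_iff.2 hz.1
  have hconst := densityConst_pos hα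
  unfold sectorDensity
  positivity

/-- The density on the right half-plane of the push-forward of `sectorMeasure` under
`z ↦ z ^ (2 / α)`. -/
noncomputable def halfPlaneDensity (α t : ℝ) (w : ℂ) : ℝ :=
  (α / 2) ^ 2 * densityConst α *
    (‖w‖ ^ (-α) * Real.exp (α ^ 2 / (2 * t) * w.re) * w.re ^ (α - 1))

lemma norm_deriv_sq_mul_sectorDensity (hα : 0 < α) (hα2 : α ≤ 2) (hw : 0 < w.re) :
    ‖((α / 2 : ℝ) : ℂ) * w ^ ((α / 2 - 1 : ℝ) : ℂ)‖ ^ 2 *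
      sectorDensity α t (w ^ ((α / 2 : ℝ) : ℂ)) = halfPlaneDensity α t w := by
  have hw0 : 0 < ‖w‖ := norm_pos_iff.2 (ne_zero_of_re_pos hw)
  have hpow : (‖w‖ ^ (α / 2 - 1)) ^ 2 * (‖w‖ ^ (α / 2)) ^ (4 * (1 - α) / α) = ‖w‖ ^ (-α) := by
    rw [← Real.rpow_natCast, ← Real.rpow_mul hw0.le, ← Real.rpow_mul hw0.le, ← Real.rpow_add hw0]
    congr 1
    field_simp
    push_cast
    ring
  rw [halfPlaneDensity, ← hpow, sectorDensity, rePow_cpow_half hα hα2 hw, norm_mul,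
    Complex.norm_cpow_real, Complex.norm_cpow_real, Complex.norm_real,
    Real.norm_of_nonneg (by positivity)]
  ring

lemma sectorMeasure_eq_withDensity (α t : ℝ) : sectorMeasure α t =
    (areaMeasure α).withDensity fun z => ENNReal.ofReal (sectorDensity α t z) := rfl

lemma measurable_ofReal_sectorDensity (α t : ℝ) :
    Measurable fun z : sector α => ENNReal.ofReal (sectorDensity α t z) :=
  ((measurable_sectorDensity α t).comp measurable_subtype_coe).ennreal_ofReal

lemma measurableSet_re_pos : MeasurableSet {w : ℂ | 0 < w.re} :=
  measurableSet_lt measurable_const Complex.measurable_re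

variable {E : Type*} [NormedAddCommGroup E] [NormedSpace ℝ E]

lemma integrable_sectorMeasure_iff_integrable_areaMeasure (hα : 0 < α) (Φ : sector α → E) :
    Integrable Φ (sectorMeasure α t) ↔
      Integrable (fun z : sector α => sectorDensity α t z • Φ z) (areaMeasure α) := by
  rw [sectorMeasure_eq_withDensity, integrable_withDensity_iff_integrable_smul'
    (measurable_ofReal_sectorDensity α t) (.of_forall fun _ => ENNReal.ofReal_lt_top)]
  simp only [fun z : sector α => ENNReal.toReal_ofReal (sectorDensity_pos (t := t) hα z.2).le]

lemma integral_sectorMeasure_eq_integral_areaMeasure (hα : 0 < α) (Φ : sector α → E) :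
    ∫ z, Φ z ∂sectorMeasure α t = ∫ z : sector α, sectorDensity α t z • Φ z ∂areaMeasure α := by
  rw [sectorMeasure_eq_withDensity, integral_withDensity_eq_integral_toReal_smul
    (measurable_ofReal_sectorDensity α t) (.of_forall fun _ => ENNReal.ofReal_lt_top)]
  simp only [fun z : sector α => ENNReal.toReal_ofReal (sectorDensity_pos (t := t) hα z.2).le]

lemma integrable_sectorMeasure_iff (hα : 0 < α) (hα2 : α ≤ 2) (Φ : ℂ → E) :
    Integrable (fun z : sector α => Φ z) (sectorMeasure α t) ↔
      IntegrableOn (fun w => halfPlaneDensity α t w • Φ (w ^ ((α / 2 : ℝ) : ℂ)))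
        {w | 0 < w.re} := by
  have hbij := bijOn_cpow_half hα hα2
  rw [integrable_sectorMeasure_iff_integrable_areaMeasure hα]
  refine (integrableOn_iff_comap_subtypeVal (isOpen_sector hα2).measurableSet (μ := volume)
    (f := fun z => sectorDensity α t z • Φ z)).symm.trans ?_
  rw [← hbij.image_eq, integrableOn_image_iff_of_hasDerivAt measurableSet_re_pos
    (fun w hw => hasDerivAt_cpow_half α hw) hbij.injOn]
  refine integrableOn_congr_fun (fun w hw => ?_) measurableSet_re_pos
  rw [smul_smul, norm_deriv_sq_mul_sectorDensity hα hα2 hw]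

lemma integral_sectorMeasure (hα : 0 < α) (hα2 : α ≤ 2) (Φ : ℂ → E) :
    ∫ z : sector α, Φ z ∂sectorMeasure α t =
      ∫ w in {w : ℂ | 0 < w.re}, halfPlaneDensity α t w • Φ (w ^ ((α / 2 : ℝ) : ℂ)) := by
  have hbij := bijOn_cpow_half hα hα2
  rw [integral_sectorMeasure_eq_integral_areaMeasure hα]
  refine (integral_subtype_comap (isOpen_sector hα2).measurableSet (μ := volume)
    fun z => sectorDensity α t z • Φ z).trans ?_
  rw [← hbij.image_eq, integral_image_eq_of_hasDerivAt measurableSet_re_pos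
    (fun w hw => hasDerivAt_cpow_half α hw) hbij.injOn]
  refine setIntegral_congr_fun measurableSet_re_pos fun w hw => ?_
  rw [smul_smul, norm_deriv_sq_mul_sectorDensity hα hα2 hw]

end SectorMeasure

section Reproducing

variable {α t : ℝ} {w z₀ : ℂ}

/-- The pull-back `w ↦ F z z⁻¹ exp (α² w / (4 t))`, `z = w ^ (α / 2)`, of a function on the sector
to the right half-plane. Up to a constant it maps `L²(sectorMeasure α t)` isometrically onto
`L²((Re w) ^ (α - 1) dA)`. -/
noncomputable def halfPlanePullback (α t : ℝ) (F : ℂ → ℂ) (w : ℂ) : ℂ :=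
  F (w ^ ((α / 2 : ℝ) : ℂ)) * (w ^ ((α / 2 : ℝ) : ℂ))⁻¹ * Complex.exp ((α ^ 2 / (4 * t) : ℝ) * w)

lemma exp_mul_conj_exp (c : ℝ) (w : ℂ) :
    Complex.exp (c * w) * conj (Complex.exp (c * w)) = (Real.exp (2 * c * w.re) : ℝ) := by
  rw [← Complex.exp_conj, map_mul, Complex.conj_ofReal, ← Complex.exp_add, ← mul_add,
    Complex.add_conj, Complex.ofReal_exp]
  push_cast
  ring_nf

lemma halfPlaneDensity_smul_mul_conj (F₁ F₂ : ℂ → ℂ) :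
    halfPlaneDensity α t w • (F₁ (w ^ ((α / 2 : ℝ) : ℂ)) * conj (F₂ (w ^ ((α / 2 : ℝ) : ℂ)))) =
      ((α / 2) ^ 2 * densityConst α) • w.re ^ (α - 1) •
        (halfPlanePullback α t F₁ w * conj (halfPlanePullback α t F₂ w)) := by
  have hnorm : (w ^ ((α / 2 : ℝ) : ℂ))⁻¹ * conj (w ^ ((α / 2 : ℝ) : ℂ))⁻¹ =
      (‖w‖ ^ (-α) : ℝ) := by
    rw [Complex.mul_conj, Complex.normSq_eq_norm_sq, norm_inv, Complex.norm_cpow_real,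
      ← Real.rpow_neg (norm_nonneg w), ← Real.rpow_natCast, ← Real.rpow_mul (norm_nonneg w)]
    norm_num
  have hexp := exp_mul_conj_exp (α ^ 2 / (4 * t)) w
  rw [show 2 * (α ^ 2 / (4 * t)) = α ^ 2 / (2 * t) by ring] at hexp
  simp only [halfPlanePullback, halfPlaneDensity, map_mul, Complex.ofReal_mul, Complex.real_smul,
    ← hnorm, ← hexp]
  ring

lemma integrable_norm_sq_sectorMeasure_iff (hα : 0 < α) (hα2 : α ≤ 2) (F : ℂ → ℂ) :
    Integrable (fun z : sector α => ‖F z‖ ^ 2) (sectorMeasure α t) ↔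
      IntegrableOn (fun w => ‖halfPlanePullback α t F w‖ ^ 2 * w.re ^ (α - 1))
        {w | 0 < w.re} := by
  have hconst : 0 < (α / 2) ^ 2 * densityConst α := mul_pos (by positivity) (densityConst_pos hα)
  rw [integrable_sectorMeasure_iff hα hα2 fun z => ‖F z‖ ^ 2]
  refine (integrableOn_congr_fun (fun w _ => ?_) measurableSet_re_pos).trans
    (integrable_const_mul_iff (isUnit_iff_ne_zero.2 hconst.ne') _)
  have hdensity := halfPlaneDensity_smul_mul_conj (α := α) (t := t) (w := w) F F
  simp only [Complex.mul_conj, Complex.normSq_eq_norm_sq, Complex.real_smul,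
    ← Complex.ofReal_mul] at hdensity
  rw [smul_eq_mul, Complex.ofReal_injective hdensity]
  ring

lemma integral_mul_conj_sectorMeasure (hα : 0 < α) (hα2 : α ≤ 2) (F₁ F₂ : ℂ → ℂ) :
    ∫ z : sector α, F₁ z * conj (F₂ z) ∂sectorMeasure α t =
      ((α / 2) ^ 2 * densityConst α) • ∫ w in {w : ℂ | 0 < w.re}, w.re ^ (α - 1) •
        (halfPlanePullback α t F₁ w * conj (halfPlanePullback α t F₂ w)) := by
  rw [integral_sectorMeasure hα hα2 fun z => F₁ z * conj (F₂ z), ← integral_smul]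
  exact setIntegral_congr_fun measurableSet_re_pos fun _ _ =>
    halfPlaneDensity_smul_mul_conj F₁ F₂

lemma differentiableOn_halfPlanePullback (hα : 0 < α) (hα2 : α ≤ 2) {F : ℂ → ℂ}
    (hF : DifferentiableOn ℂ F (sector α)) :
    DifferentiableOn ℂ (halfPlanePullback α t F) {w | 0 < w.re} := by
  have hpow : DifferentiableOn ℂ (fun w : ℂ => w ^ ((α / 2 : ℝ) : ℂ)) {w | 0 < w.re} :=
    fun w hw => (hasDerivAt_cpow_half α hw).differentiableAt.differentiableWithinAt
  have hmaps := (bijOn_cpow_half hα hα2).mapsTo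
  exact ((hF.comp hpow hmaps).mul (hpow.inv fun w hw => (hmaps hw).1)).mul (by fun_prop)

/-- The constant `Γ(α + 1) / (Γ(α / 2)² (α / 2)²)` of the reproducing kernel of `imageSpace`. -/
noncomputable def kernelConst (α : ℝ) : ℝ :=
  Real.Gamma (α + 1) / (Real.Gamma (α / 2) ^ 2 * (α / 2) ^ 2)

/-- The reproducing kernel of `imageSpace` at the point `z₀`, as a function on the plane. -/
noncomputable def sectorKernel (α t : ℝ) (z₀ z : ℂ) : ℂ :=
  kernelConst α * (z * conj z₀) *
    Complex.exp (-(((α ^ 2 / (4 * t) : ℝ) : ℂ) *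
      (z ^ ((2 / α : ℝ) : ℂ) + conj (z₀ ^ ((2 / α : ℝ) : ℂ))))) *
    halfPlaneKernel α (z₀ ^ ((2 / α : ℝ) : ℂ)) (z ^ ((2 / α : ℝ) : ℂ))

lemma halfPlanePullback_sectorKernel (hα : 0 < α) (hα2 : α ≤ 2) (z₀ : ℂ) (hw : 0 < w.re) :
    halfPlanePullback α t (sectorKernel α t z₀) w =
      conj (kernelConst α * z₀ *
        Complex.exp (-(((α ^ 2 / (4 * t) : ℝ) : ℂ) * z₀ ^ ((2 / α : ℝ) : ℂ)))) *
      halfPlaneKernel α (z₀ ^ ((2 / α : ℝ) : ℂ)) w := by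
  have hne : w ^ ((α / 2 : ℝ) : ℂ) ≠ 0 := (cpow_half_mem_sector hα hα2 hw).1
  simp only [halfPlanePullback, sectorKernel, cpow_half_cpow_two_div hα hα2 hw, map_mul,
    Complex.conj_ofReal, ← Complex.exp_conj, map_neg]
  rw [mul_add, neg_add, Complex.exp_add, Complex.exp_neg (_ * w)]
  field_simp

lemma integrable_norm_sq_sectorKernel (hα : 0 < α) (hα2 : α ≤ 2) (hz₀ : z₀ ∈ sector α) :
    Integrable (fun z : sector α => ‖sectorKernel α t z₀ z‖ ^ 2) (sectorMeasure α t) := by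
  rw [integrable_norm_sq_sectorMeasure_iff hα hα2]
  refine (integrableOn_congr_fun (fun w hw => ?_) measurableSet_re_pos).2
    ((integrableOn_halfPlaneKernel hα (rePow_pos hα hz₀)).const_mul (‖conj (kernelConst α * z₀ *
      Complex.exp (-(((α ^ 2 / (4 * t) : ℝ) : ℂ) * z₀ ^ ((2 / α : ℝ) : ℂ))))‖ ^ 2))
  rw [halfPlanePullback_sectorKernel hα hα2 z₀ hw, norm_mul, mul_pow, mul_assoc]

lemma differentiableOn_sectorKernel (hα : 0 < α) (hα2 : α ≤ 2) (hz₀ : z₀ ∈ sector α) :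
    DifferentiableOn ℂ (sectorKernel α t z₀) (sector α) := by
  have hpow := differentiableOn_cpow_sector hα2 ((2 / α : ℝ) : ℂ)
  have hkernel : DifferentiableOn ℂ (fun z : ℂ => halfPlaneKernel α (z₀ ^ ((2 / α : ℝ) : ℂ))
      (z ^ ((2 / α : ℝ) : ℂ))) (sector α) :=
    (hpow.add_const _).cpow (by fun_prop) fun z hz =>
      .inl (add_pos (rePow_pos hα hz) (rePow_pos hα hz₀))
  unfold sectorKernel
  exact DifferentiableOn.mul (by fun_prop) hkernel

lemma densityConst_mul_kernelConst (hα : 0 < α) :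
    (α / 2) ^ 2 * densityConst α * kernelConst α * (Real.pi * 2 ^ (1 - α) / α) = 1 := by
  have htwo : (2 : ℝ) ^ (1 - α) = (2 ^ (α - 1))⁻¹ := by
    rw [← Real.rpow_neg two_pos.le, neg_sub]
  rw [densityConst, kernelConst, ProbabilityTheory.beta, add_halves, htwo,
    Real.Gamma_add_one hα.ne']
  field_simp

lemma integral_mul_conj_sectorKernel (hα : 0 < α) (hα2 : α ≤ 2) {F : ℂ → ℂ}
    (hF : DifferentiableOn ℂ F (sector α))
    (hint : Integrable (fun z : sector α => ‖F z‖ ^ 2) (sectorMeasure α t))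
    (hz₀ : z₀ ∈ sector α) :
    ∫ z : sector α, F z * conj (sectorKernel α t z₀ z) ∂sectorMeasure α t = F z₀ := by
  set e := Complex.exp (((α ^ 2 / (4 * t) : ℝ) : ℂ) * z₀ ^ ((2 / α : ℝ) : ℂ)) with he
  have he0 : e ≠ 0 := Complex.exp_ne_zero _
  have hz₀0 : z₀ ≠ 0 := hz₀.1
  have hconst : (((α / 2) ^ 2 * densityConst α : ℝ) : ℂ) * kernelConst α *
      ((Real.pi * 2 ^ (1 - α) / α : ℝ) : ℂ) = 1 := by
    exact_mod_cast densityConst_mul_kernelConst hα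
  calc
    _ = ((α / 2) ^ 2 * densityConst α) • ∫ w in {w : ℂ | 0 < w.re}, (kernelConst α * z₀ * e⁻¹) •
          w.re ^ (α - 1) • (halfPlanePullback α t F w *
            conj (halfPlaneKernel α (z₀ ^ ((2 / α : ℝ) : ℂ)) w)) := by
      rw [integral_mul_conj_sectorMeasure hα hα2]
      congr 1
      refine setIntegral_congr_fun measurableSet_re_pos fun w hw => ?_
      simp only [halfPlanePullback_sectorKernel hα hα2 z₀ hw, map_mul, Complex.conj_conj,
        Complex.exp_neg, ← he, Complex.real_smul, smul_eq_mul]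
      ring
    _ = ((α / 2) ^ 2 * densityConst α) • (kernelConst α * z₀ * e⁻¹) •
          (Real.pi * 2 ^ (1 - α) / α) • (F z₀ * z₀⁻¹ * e) := by
      rw [integral_smul, setIntegral_halfPlane_mul_conj_halfPlaneKernel hα
        (differentiableOn_halfPlanePullback hα hα2 hF)
        ((integrable_norm_sq_sectorMeasure_iff hα hα2 F).1 hint) (rePow_pos hα hz₀),
        halfPlanePullback, cpow_two_div_cpow_half hα hz₀]
    _ = (((α / 2) ^ 2 * densityConst α : ℝ) : ℂ) * kernelConst α *
          ((Real.pi * 2 ^ (1 - α) / α : ℝ) : ℂ) * F z₀ := by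
      simp only [Complex.real_smul, smul_eq_mul]
      field_simp
    _ = F z₀ := by rw [hconst, one_mul]

end Reproducing

section GammaIntegral

/-- The measure `s ^ p ds` on the positive half-line, whose moment generating function is a Gamma
integral. -/
noncomputable def powMeasure (p : ℝ) : Measure ℝ :=
  (volume.restrict (Set.Ioi 0)).withDensity fun s => ENNReal.ofReal (s ^ p)

lemma integrable_exp_mul_powMeasure {p b : ℝ} (hp : -1 < p) (hb : b < 0) :
    Integrable (fun s => Real.exp (b * s)) (powMeasure p) := by
  rw [powMeasure, integrable_withDensity_iff_integrable_smul' (by fun_prop)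
    (.of_forall fun _ => ENNReal.ofReal_lt_top)]
  refine (integrableOn_rpow_mul_exp_neg_mul_rpow hp one_pos (neg_pos.2 hb)).congr ?_
  filter_upwards [ae_restrict_mem measurableSet_Ioi] with s hs
  rw [ENNReal.toReal_ofReal (Real.rpow_nonneg hs.le p), Real.rpow_one, neg_neg, smul_eq_mul]

lemma complexMGF_powMeasure (p : ℝ) (β : ℂ) :
    ProbabilityTheory.complexMGF id (powMeasure p) (-β) =
      ∫ s in Set.Ioi (0 : ℝ), ((s ^ p : ℝ) : ℂ) * Complex.exp (-β * s) := by
  rw [ProbabilityTheory.complexMGF, powMeasure,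
    integral_withDensity_eq_integral_toReal_smul (by fun_prop)
      (.of_forall fun _ => ENNReal.ofReal_lt_top)]
  refine setIntegral_congr_fun measurableSet_Ioi fun s hs => ?_
  simp only [ENNReal.toReal_ofReal (Real.rpow_nonneg hs.le p), Complex.real_smul, id_eq]

lemma differentiableOn_integral_rpow_mul_cexp {p : ℝ} (hp : -1 < p) :
    DifferentiableOn ℂ (fun β : ℂ => ∫ s in Set.Ioi (0 : ℝ), ((s ^ p : ℝ) : ℂ) *
      Complex.exp (-β * s)) {β | 0 < β.re} := by
  simp only [← complexMGF_powMeasure]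
  refine ProbabilityTheory.differentiableOn_complexMGF.comp (differentiableOn_neg _) fun β hβ => ?_
  have hsub : Set.Iio 0 ⊆ ProbabilityTheory.integrableExpSet id (powMeasure p) :=
    fun b hb => integrable_exp_mul_powMeasure hp hb
  exact interior_maximal hsub isOpen_Iio (neg_neg_of_pos hβ : -β.re < 0)

lemma integral_rpow_mul_cexp_ofReal {p r : ℝ} (hp : -1 < p) (hr : 0 < r) :
    ∫ s in Set.Ioi (0 : ℝ), ((s ^ p : ℝ) : ℂ) * Complex.exp (-(r : ℂ) * s) =
      (Real.Gamma (p + 1) : ℂ) * (r : ℂ) ^ ((-(p + 1) : ℝ) : ℂ) := by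
  have h := Real.integral_rpow_mul_exp_neg_mul_Ioi (a := p + 1) (by linarith) hr
  rw [add_sub_cancel_right, one_div, Real.inv_rpow hr.le, ← Real.rpow_neg hr.le] at h
  rw [← Complex.ofReal_cpow hr.le, ← Complex.ofReal_mul, mul_comm (Real.Gamma _), ← h,
    ← integral_complex_ofReal]
  push_cast
  simp only [neg_mul]

lemma integral_rpow_mul_cexp {p : ℝ} (hp : -1 < p) {β : ℂ} (hβ : 0 < β.re) :
    ∫ s in Set.Ioi (0 : ℝ), ((s ^ p : ℝ) : ℂ) * Complex.exp (-β * s) =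
      (Real.Gamma (p + 1) : ℂ) * β ^ ((-(p + 1) : ℝ) : ℂ) := by
  have hopen : IsOpen {β : ℂ | 0 < β.re} := isOpen_lt continuous_const Complex.continuous_re
  have hconn : IsPreconnected {β : ℂ | 0 < β.re} := (convex_halfSpace_re_gt 0).isPreconnected
  have hleft := (differentiableOn_integral_rpow_mul_cexp hp).analyticOnNhd hopen
  have hright : AnalyticOnNhd ℂ (fun β : ℂ => (Real.Gamma (p + 1) : ℂ) *
      β ^ ((-(p + 1) : ℝ) : ℂ)) {β | 0 < β.re} :=
    ((differentiableOn_id.cpow (differentiableOn_const _) fun _ hz => Or.inl hz).const_mul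
      _).analyticOnNhd hopen
  have hreal : Tendsto (fun r : ℝ => (r : ℂ)) (𝓝[≠] (1 : ℝ)) (𝓝[≠] (1 : ℂ)) :=
    Complex.ofReal_one ▸ Complex.continuous_ofReal.continuousWithinAt.tendsto_nhdsWithin
      fun r hr => Complex.ofReal_injective.ne hr
  have hfreq : ∃ᶠ z in 𝓝[≠] (1 : ℂ), ∫ s in Set.Ioi (0 : ℝ), ((s ^ p : ℝ) : ℂ) *
      Complex.exp (-z * s) = (Real.Gamma (p + 1) : ℂ) * z ^ ((-(p + 1) : ℝ) : ℂ) := by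
    refine hreal.frequently (Eventually.frequently ?_)
    filter_upwards [nhdsWithin_le_nhds (lt_mem_nhds one_pos)] with r hr
    exact integral_rpow_mul_cexp_ofReal hp hr
  exact hleft.eqOn_of_preconnected_of_frequently_eq hright hconn
    (show 0 < (1 : ℂ).re from one_pos) hfreq hβ

end GammaIntegral

section IntervalIntegral

variable {p t : ℝ}

lemma image_sub_inv_add_inv (ht : 0 < t) :
    (fun s => t - (s + t⁻¹)⁻¹) '' Set.Ioi 0 = Set.Ioo 0 t := by
  ext τ
  constructor
  · rintro ⟨s, hs : 0 < s, rfl⟩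
    refine ⟨sub_pos.2 ?_, sub_lt_self _ (by positivity)⟩
    rw [inv_lt_comm₀ (by positivity) ht]
    exact lt_add_of_pos_left _ hs
  · rintro ⟨hτ0, hτt⟩
    refine ⟨(t - τ)⁻¹ - t⁻¹, ?_, by simp⟩
    exact sub_pos.2 ((inv_lt_inv₀ ht (sub_pos.2 hτt)).2 (sub_lt_self t hτ0))

lemma setIntegral_Ioo_eq_setIntegral_Ioi {E : Type*} [NormedAddCommGroup E] [NormedSpace ℝ E]
    (ht : 0 < t) (f : ℝ → E) :
    ∫ τ in Set.Ioo 0 t, f τ =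
      ∫ s in Set.Ioi (0 : ℝ), ((s + t⁻¹) ^ 2)⁻¹ • f (t - (s + t⁻¹)⁻¹) := by
  have hderiv : ∀ s ∈ Set.Ioi (0 : ℝ), HasDerivWithinAt (fun s => t - (s + t⁻¹)⁻¹)
      (((s + t⁻¹) ^ 2)⁻¹) (Set.Ioi 0) s := by
    intro s (hs : 0 < s)
    have h := (((hasDerivAt_id s).add_const t⁻¹).fun_inv (by positivity)).const_sub t
    simpa only [id_eq, neg_div, neg_neg, one_div] using h.hasDerivWithinAt
  have hinj : Set.InjOn (fun s => t - (s + t⁻¹)⁻¹) (Set.Ioi 0) := fun s _ s' _ h =>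
    add_right_cancel (inv_injective (sub_right_injective h))
  rw [← image_sub_inv_add_inv ht,
    integral_image_eq_integral_abs_deriv_smul measurableSet_Ioi hderiv hinj]
  simp only [abs_inv, abs_pow, sq_abs]

lemma rpow_div_rpow_sub_inv_add_inv (p : ℝ) (ht : 0 < t) {s : ℝ} (hs : 0 < s) :
    ((s + t⁻¹) ^ 2)⁻¹ * ((t - (s + t⁻¹)⁻¹) ^ p / (s + t⁻¹)⁻¹ ^ (p + 2)) = t ^ p * s ^ p := by
  have hmul : t - (s + t⁻¹)⁻¹ = t * s * (s + t⁻¹)⁻¹ := by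
    field_simp
    ring
  rw [hmul, Real.mul_rpow (by positivity) (by positivity), Real.mul_rpow ht.le hs.le,
    Real.rpow_add (by positivity), Real.rpow_two, Real.inv_rpow (by positivity)]
  field_simp

lemma setIntegral_Ioo_rpow_mul_cexp_div (hp : -1 < p) (ht : 0 < t) {β : ℂ} (hβ : 0 < β.re) :
    ∫ τ in Set.Ioo 0 t, ((τ ^ p / (t - τ) ^ (p + 2) : ℝ) : ℂ) *
        Complex.exp (-β / ((t : ℂ) - τ)) =
      (t ^ p : ℝ) * Complex.exp (-β / t) *
        ((Real.Gamma (p + 1) : ℂ) * β ^ ((-(p + 1) : ℝ) : ℂ)) := by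
  rw [setIntegral_Ioo_eq_setIntegral_Ioi ht, ← integral_rpow_mul_cexp hp hβ,
    ← integral_const_mul]
  refine setIntegral_congr_fun measurableSet_Ioi fun s hs => ?_
  have hsub : t - (t - (s + t⁻¹)⁻¹) = (s + t⁻¹)⁻¹ := sub_sub_cancel t _
  have hexp : -β / (((s + t⁻¹)⁻¹ : ℝ) : ℂ) = -β / t + -β * s := by
    push_cast
    rw [div_inv_eq_mul]
    ring
  simp only [← Complex.ofReal_sub, hsub, hexp, Complex.exp_add, Complex.real_smul]
  rw [← mul_assoc, ← Complex.ofReal_mul, rpow_div_rpow_sub_inv_add_inv p ht hs, Complex.ofReal_mul]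
  ring

end IntervalIntegral

section Oscillation

variable {X : Type*} [MeasurableSpace X] {ν : Measure X} {ψ : X → ℝ}

lemma integrable_mul_cexp_mul_I {q : X → ℂ} (hq : Integrable q ν) (hψ : Measurable ψ) (x : ℝ) :
    Integrable (fun τ => q τ * Complex.exp (x * ψ τ * Complex.I)) ν := by
  refine hq.mul_bdd (c := 1) (by fun_prop) (.of_forall fun τ => ?_)
  rw [← Complex.ofReal_mul, Complex.norm_exp_ofReal_mul_I]

lemma charFun_map_withDensity_ofReal {q : X → ℝ} (hq : Integrable q ν) (hq0 : 0 ≤ q)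
    (hψ : MeasurableEmbedding ψ) (x : ℝ) :
    charFun ((ν.withDensity fun τ => ENNReal.ofReal (q τ)).map ψ) x =
      ∫ τ, (q τ : ℂ) * Complex.exp (x * ψ τ * Complex.I) ∂ν := by
  rw [charFun_apply_real, hψ.integral_map,
    integral_withDensity_eq_integral_toReal_smul₀ hq.1.aemeasurable.ennreal_ofReal
      (.of_forall fun _ => ENNReal.ofReal_lt_top)]
  simp only [ENNReal.toReal_ofReal (hq0 _), Complex.real_smul]

lemma ae_eq_of_integral_ofReal_mul_cexp_eq {p q : X → ℝ} (hp : Integrable p ν)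
    (hq : Integrable q ν) (hp0 : 0 ≤ p) (hq0 : 0 ≤ q) (hψ : MeasurableEmbedding ψ)
    (h : ∀ x : ℝ, ∫ τ, (p τ : ℂ) * Complex.exp (x * ψ τ * Complex.I) ∂ν =
      ∫ τ, (q τ : ℂ) * Complex.exp (x * ψ τ * Complex.I) ∂ν) : p =ᵐ[ν] q := by
  have := isFiniteMeasure_withDensity_ofReal hp.2
  have := isFiniteMeasure_withDensity_ofReal hq.2
  have hmap : (ν.withDensity fun τ => ENNReal.ofReal (p τ)).map ψ =
      (ν.withDensity fun τ => ENNReal.ofReal (q τ)).map ψ := by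
    refine Measure.ext_of_charFun (funext fun x => ?_)
    rw [charFun_map_withDensity_ofReal hp hp0 hψ, charFun_map_withDensity_ofReal hq hq0 hψ, h]
  have hdensity : (ν.withDensity fun τ => ENNReal.ofReal (p τ)) =
      ν.withDensity fun τ => ENNReal.ofReal (q τ) := by
    rw [← hψ.comap_map (ν.withDensity _), hmap, hψ.comap_map]
  have hfin : ∫⁻ τ, ENNReal.ofReal (p τ) ∂ν ≠ ⊤ := hp.lintegral_lt_top.ne
  filter_upwards [(withDensity_eq_iff hp.1.aemeasurable.ennreal_ofReal
    hq.1.aemeasurable.ennreal_ofReal hfin).1 hdensity] with τ hτ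
  exact (ENNReal.ofReal_eq_ofReal_iff (hp0 τ) (hq0 τ)).1 hτ

lemma ae_eq_zero_of_integral_ofReal_mul_cexp_eq_zero {h : X → ℝ} (hh : Integrable h ν)
    (hψ : MeasurableEmbedding ψ)
    (h0 : ∀ x : ℝ, ∫ τ, (h τ : ℂ) * Complex.exp (x * ψ τ * Complex.I) ∂ν = 0) : h =ᵐ[ν] 0 := by
  have hsub : ∀ τ, h τ = max (h τ) 0 - max (-h τ) 0 := fun τ =>
    (max_zero_sub_max_neg_zero_eq_self (h τ)).symm
  have hae : (fun τ => max (h τ) 0) =ᵐ[ν] fun τ => max (-h τ) 0 := by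
    refine ae_eq_of_integral_ofReal_mul_cexp_eq hh.pos_part hh.neg_part
      (fun _ => le_max_right _ _) (fun _ => le_max_right _ _) hψ fun x => ?_
    have hpos := integrable_mul_cexp_mul_I hh.pos_part.ofReal hψ.measurable x
    have hneg := integrable_mul_cexp_mul_I hh.neg_part.ofReal hψ.measurable x
    refine sub_eq_zero.1 ((integral_sub hpos hneg).symm.trans ?_)
    simpa only [← sub_mul, ← Complex.ofReal_sub, RCLike.ofReal_eq_complex_ofReal, ← hsub]
      using h0 x
  filter_upwards [hae] with τ hτ
  rw [hsub, hτ, sub_self, Pi.zero_apply]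

lemma integral_conj_mul_cexp_eq_zero {G : X → ℂ}
    (h0 : ∀ x : ℝ, ∫ τ, G τ * Complex.exp (x * ψ τ * Complex.I) ∂ν = 0) (x : ℝ) :
    ∫ τ, conj (G τ) * Complex.exp (x * ψ τ * Complex.I) ∂ν = 0 := by
  rw [← map_zero conj, ← h0 (-x), ← integral_conj]
  simp only [map_mul, ← Complex.exp_conj, Complex.conj_ofReal, Complex.conj_I, Complex.ofReal_neg,
    neg_mul, mul_neg, neg_neg, map_neg]

lemma ae_eq_zero_of_integral_mul_cexp_eq_zero {G : X → ℂ} (hG : Integrable G ν)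
    (hψ : MeasurableEmbedding ψ)
    (h0 : ∀ x : ℝ, ∫ τ, G τ * Complex.exp (x * ψ τ * Complex.I) ∂ν = 0) : G =ᵐ[ν] 0 := by
  have hconj : Integrable (fun τ => conj (G τ)) ν :=
    Complex.conjCLE.toContinuousLinearMap.integrable_comp hG
  have hlin : ∀ (a b : ℂ) (x : ℝ),
      ∫ τ, (a * G τ + b * conj (G τ)) * Complex.exp (x * ψ τ * Complex.I) ∂ν = 0 := by
    intro a b x
    simp only [add_mul, mul_assoc a, mul_assoc b]
    rw [integral_add ((integrable_mul_cexp_mul_I hG hψ.measurable x).const_mul a)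
      ((integrable_mul_cexp_mul_I hconj hψ.measurable x).const_mul b), integral_const_mul,
      integral_const_mul, h0, integral_conj_mul_cexp_eq_zero h0, mul_zero, mul_zero, add_zero]
  have hre : (fun τ => (G τ).re) =ᵐ[ν] 0 := by
    refine ae_eq_zero_of_integral_ofReal_mul_cexp_eq_zero hG.re hψ fun x => ?_
    rw [← hlin (1 / 2) (1 / 2) x]
    simp only [Complex.re_eq_add_conj, add_div, one_div_mul_eq_div]
  have him : (fun τ => (G τ).im) =ᵐ[ν] 0 := by
    refine ae_eq_zero_of_integral_ofReal_mul_cexp_eq_zero hG.im hψ fun x => ?_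
    rw [← hlin (1 / (2 * Complex.I)) (-(1 / (2 * Complex.I))) x]
    simp only [Complex.im_eq_sub_conj, neg_mul, ← sub_eq_add_neg, sub_div, one_div_mul_eq_div]
  filter_upwards [hre, him] with τ hτre hτim
  exact Complex.ext hτre hτim

end Oscillation

section DataMeasure

variable {α t : ℝ} {E : Type*} [NormedAddCommGroup E] [NormedSpace ℝ E]

lemma toReal_dataDensity (α : ℝ) {τ : ℝ} (hτ : τ ∈ Set.Ioo 0 t) :
    (ENNReal.ofReal (τ ^ α / t ^ α)).toReal = τ ^ α / t ^ α :=
  ENNReal.toReal_ofReal (div_nonneg (Real.rpow_nonneg hτ.1.le α)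
    (Real.rpow_nonneg (hτ.1.trans hτ.2).le α))

lemma isFiniteMeasure_dataMeasure (hα : 0 < α) (ht : 0 < t) :
    IsFiniteMeasure (dataMeasure α t) := by
  refine ⟨?_⟩
  rw [dataMeasure, withDensity_apply _ MeasurableSet.univ, Measure.restrict_univ]
  calc ∫⁻ τ in Set.Ioo 0 t, ENNReal.ofReal (τ ^ α / t ^ α)
      ≤ ∫⁻ _ in Set.Ioo 0 t, 1 := by
        refine setLIntegral_mono measurable_const fun τ hτ => ENNReal.ofReal_le_one.2 ?_
        exact div_le_one_of_le₀ (Real.rpow_le_rpow hτ.1.le hτ.2.le hα.le) (by positivity)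
    _ < ⊤ := by
        rw [setLIntegral_one, Real.volume_Ioo]
        exact ENNReal.ofReal_lt_top

lemma ae_dataMeasure_mem (α t : ℝ) : ∀ᵐ τ ∂dataMeasure α t, τ ∈ Set.Ioo 0 t :=
  (withDensity_absolutelyContinuous _ _).ae_le (ae_restrict_mem measurableSet_Ioo)

lemma integrable_dataMeasure_iff (φ : ℝ → E) :
    Integrable φ (dataMeasure α t) ↔
      IntegrableOn (fun τ => (τ ^ α / t ^ α) • φ τ) (Set.Ioo 0 t) := by
  rw [dataMeasure, integrable_withDensity_iff_integrable_smul' (by fun_prop)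
    (.of_forall fun _ => ENNReal.ofReal_lt_top)]
  refine integrableOn_congr_fun (fun τ hτ => ?_) measurableSet_Ioo
  simp only [toReal_dataDensity α hτ]

lemma integral_dataMeasure (φ : ℝ → E) :
    ∫ τ, φ τ ∂dataMeasure α t = ∫ τ in Set.Ioo 0 t, (τ ^ α / t ^ α) • φ τ := by
  rw [dataMeasure, integral_withDensity_eq_integral_toReal_smul (by fun_prop)
    (.of_forall fun _ => ENNReal.ofReal_lt_top)]
  refine setIntegral_congr_fun measurableSet_Ioo fun τ hτ => ?_
  simp only [toReal_dataDensity α hτ]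

end DataMeasure

section OperatorKernel

variable {α t τ : ℝ}

/-- The normalizing constant `(α / 2) ^ α / Γ(α / 2)` of the operator `L_t^α`. -/
noncomputable def operatorConst (α : ℝ) : ℝ := (α / 2) ^ α / Real.Gamma (α / 2)

/-- The kernel of the operator `L_t^α` with respect to `dataMeasure`. -/
noncomputable def operatorKernel (α t : ℝ) (z : ℂ) (τ : ℝ) : ℂ :=
  operatorConst α * (z / (((t - τ) ^ (α / 2 + 1) : ℝ) : ℂ)) *
    Complex.exp (-((α : ℂ) ^ 2 * z ^ ((2 / α : ℝ) : ℂ)) / (4 * ((t : ℂ) - (τ : ℂ))))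

lemma operatorConst_pos (hα : 0 < α) : 0 < operatorConst α :=
  div_pos (by positivity) (Real.Gamma_pos_of_pos (by positivity))

lemma measurable_operatorKernel (α t : ℝ) :
    Measurable (Function.uncurry (operatorKernel α t)) := by
  unfold operatorKernel Function.uncurry
  fun_prop

lemma measurable_conj_operatorKernel (α t : ℝ) : Measurable
    (Function.uncurry fun (z : sector α) (τ : ℝ) => conj (operatorKernel α t z τ)) := by
  have hcoe : Measurable fun p : sector α × ℝ => ((p.1 : ℂ), p.2) := by fun_prop
  have hkernel := (measurable_operatorKernel α t).comp hcoe
  exact Complex.continuous_conj.measurable.comp hkernel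

lemma operatorKernel_ne_zero (hα : 0 < α) (hτ : τ < t) {z : ℂ} (hz : z ≠ 0) :
    operatorKernel α t z τ ≠ 0 := by
  have hconst : (operatorConst α : ℂ) ≠ 0 := Complex.ofReal_ne_zero.2 (operatorConst_pos hα).ne'
  have hpow : (((t - τ) ^ (α / 2 + 1) : ℝ) : ℂ) ≠ 0 :=
    Complex.ofReal_ne_zero.2 (Real.rpow_pos_of_pos (sub_pos.2 hτ) _).ne'
  exact mul_ne_zero (mul_ne_zero hconst (div_ne_zero hz hpow)) (Complex.exp_ne_zero _)

lemma neg_sq_mul_div_four_mul_sub (α t τ : ℝ) (w : ℂ) :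
    -((α : ℂ) ^ 2 * w) / (4 * ((t : ℂ) - τ)) = ((-(α ^ 2 / 4 * (t - τ)⁻¹) : ℝ) : ℂ) * w := by
  push_cast
  rw [div_eq_mul_inv, mul_inv]
  ring

lemma norm_operatorKernel (hα : 0 < α) (hτ : τ < t) (z : ℂ) :
    ‖operatorKernel α t z τ‖ = operatorConst α * ‖z‖ * ((t - τ)⁻¹ ^ (α / 2 + 1) *
      Real.exp (-(α ^ 2 * rePow α z / 4 * (t - τ)⁻¹))) := by
  have hpos : 0 < t - τ := sub_pos.2 hτ
  have hconst := operatorConst_pos hα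
  rw [operatorKernel, neg_sq_mul_div_four_mul_sub, norm_mul, norm_mul, norm_div, Complex.norm_real,
    Complex.norm_real, Real.norm_of_nonneg (by positivity), Real.norm_of_nonneg (by positivity),
    Complex.norm_exp, Complex.re_ofReal_mul, ← rePow, Real.inv_rpow hpos.le]
  ring_nf

lemma rpow_mul_exp_neg_le {p c u : ℝ} (hp : 0 < p) (hc : 0 < c) (hu : 0 < u) :
    u ^ p * Real.exp (-(c * u)) ≤ (p / c) ^ p := by
  have hexp : (c * u / p) ^ p ≤ Real.exp (c * u) := by
    calc (c * u / p) ^ p ≤ Real.exp (c * u / p) ^ p := by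
          refine Real.rpow_le_rpow (by positivity) ?_ hp.le
          linarith [Real.add_one_le_exp (c * u / p)]
      _ = Real.exp (c * u) := by
          rw [← Real.exp_mul, div_mul_cancel₀ _ hp.ne']
  calc u ^ p * Real.exp (-(c * u))
      = (p / c) ^ p * ((c * u / p) ^ p * (Real.exp (c * u))⁻¹) := by
        rw [← mul_assoc, ← Real.mul_rpow (by positivity) (by positivity), Real.exp_neg]
        congr 2
        field_simp
    _ ≤ (p / c) ^ p :=
        mul_le_of_le_one_right (by positivity) (mul_inv_le_one_of_le₀ hexp (Real.exp_pos _).le)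

lemma continuous_rePow_sector (hα2 : α ≤ 2) : Continuous fun z : sector α => rePow α z :=
  Complex.continuous_re.comp
    (continuousOn_iff_continuous_domRestrict.1 (differentiableOn_cpow_sector hα2 _).continuousOn)

lemma exists_norm_operatorKernel_le (t : ℝ) (hα : 0 < α) (hα2 : α ≤ 2) {E : Set (sector α)}
    (hE : IsCompact E) :
    ∃ M, ∀ z ∈ E, ∀ τ < t, ‖operatorKernel α t z τ‖ ≤ M := by
  obtain ⟨R, hR⟩ := hE.exists_bound_of_continuousOn
    (f := fun z : sector α => (z : ℂ)) continuous_subtype_val.continuousOn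
  obtain ⟨δ, hδ, hδE⟩ := hE.exists_forall_le' (continuous_rePow_sector hα2).continuousOn
    (fun z _ => rePow_pos hα z.2)
  refine ⟨operatorConst α * R * ((α / 2 + 1) / (α ^ 2 * δ / 4)) ^ (α / 2 + 1),
    fun z hz τ hτ => ?_⟩
  have hconst := operatorConst_pos hα
  have hpos : 0 < t - τ := sub_pos.2 hτ
  have hR0 : 0 ≤ R := (norm_nonneg _).trans (hR z hz)
  calc ‖operatorKernel α t z τ‖
      ≤ operatorConst α * R * ((t - τ)⁻¹ ^ (α / 2 + 1) *
          Real.exp (-(α ^ 2 * δ / 4 * (t - τ)⁻¹))) := by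
        rw [norm_operatorKernel hα hτ]
        gcongr
        exacts [hR z hz, hδE z hz]
    _ ≤ _ := by
        gcongr
        exact rpow_mul_exp_neg_le (by positivity) (by positivity) (inv_pos.2 hpos)

lemma memLp_conj_operatorKernel (hα : 0 < α) (hα2 : α ≤ 2) (ht : 0 < t) (z : sector α) :
    MemLp (fun τ => conj (operatorKernel α t z τ)) 2 (dataMeasure α t) := by
  have := isFiniteMeasure_dataMeasure hα ht
  obtain ⟨M, hM⟩ := exists_norm_operatorKernel_le t hα hα2 (isCompact_singleton (x := z))
  refine MemLp.of_bound (C := M) ?_ ?_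
  · exact (measurable_conj_operatorKernel α t).of_uncurry_left.aestronglyMeasurable
  · filter_upwards [ae_dataMeasure_mem α t] with τ hτ
    exact (RCLike.norm_conj _).trans_le (hM z rfl τ hτ.2)

lemma smul_mul_operatorKernel (α t : ℝ) (g : ℝ → ℂ) (z : ℂ) (τ : ℝ) :
    (τ ^ α / t ^ α) • (g τ * operatorKernel α t z τ) =
      ((operatorConst α / t ^ α : ℝ) : ℂ) * operatorIntegrand α t g z τ := by
  rw [operatorIntegrand, operatorKernel, Complex.real_smul]
  push_cast
  ring

lemma integrable_mul_operatorKernel_iff (hα : 0 < α) (ht : 0 < t) (g : ℝ → ℂ) (z : ℂ) :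
    Integrable (fun τ => g τ * operatorKernel α t z τ) (dataMeasure α t) ↔
      IntegrableOn (operatorIntegrand α t g z) (Set.Ioo 0 t) := by
  have hconst : ((operatorConst α / t ^ α : ℝ) : ℂ) ≠ 0 :=
    Complex.ofReal_ne_zero.2 (div_pos (operatorConst_pos hα) (Real.rpow_pos_of_pos ht α)).ne'
  rw [integrable_dataMeasure_iff]
  simp only [smul_mul_operatorKernel]
  exact integrable_const_mul_iff hconst.isUnit _

lemma integral_mul_operatorKernel (g : ℝ → ℂ) (z : sector α) :
    ∫ τ, g τ * operatorKernel α t z τ ∂dataMeasure α t = sectorOperator α t g z := by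
  rw [integral_dataMeasure]
  simp only [smul_mul_operatorKernel]
  rw [integral_const_mul, sectorOperator, operatorConst, div_div]

/-- The function that represents `g ↦ L_t^α g(z)` in the Hilbert space `L²(dataMeasure)`. -/
noncomputable def featureMap (hα : 0 < α) (hα2 : α ≤ 2) (ht : 0 < t) (z : sector α) :
    Lp ℂ 2 (dataMeasure α t) :=
  (memLp_conj_operatorKernel hα hα2 ht z).toLp

lemma inner_featureMap_ae (hα : 0 < α) (hα2 : α ≤ 2) (ht : 0 < t)
    (g : Lp ℂ 2 (dataMeasure α t)) (z : sector α) :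
    (fun τ => ⟪featureMap hα hα2 ht z τ, g τ⟫_ℂ) =ᵐ[dataMeasure α t]
      fun τ => g τ * operatorKernel α t z τ := by
  filter_upwards [(memLp_conj_operatorKernel hα hα2 ht z).coeFn_toLp] with τ hτ
  rw [featureMap, hτ, RCLike.inner_apply, Complex.conj_conj]

lemma integrable_mul_operatorKernel (hα : 0 < α) (hα2 : α ≤ 2) (ht : 0 < t)
    (g : Lp ℂ 2 (dataMeasure α t)) (z : sector α) :
    Integrable (fun τ => g τ * operatorKernel α t z τ) (dataMeasure α t) :=
  (L2.integrable_inner (𝕜 := ℂ) (featureMap hα hα2 ht z) g).congr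
    (inner_featureMap_ae hα hα2 ht g z)

lemma inner_featureMap (hα : 0 < α) (hα2 : α ≤ 2) (ht : 0 < t)
    (g : Lp ℂ 2 (dataMeasure α t)) (z : sector α) :
    ⟪featureMap hα hα2 ht z, g⟫_ℂ = sectorOperator α t g z := by
  rw [L2.inner_def, integral_congr_ae (inner_featureMap_ae hα hα2 ht g z),
    integral_mul_operatorKernel]

end OperatorKernel

section GramKernel

variable {α t τ : ℝ}

lemma conj_operatorKernel_mul_operatorKernel (hτ : τ < t) (z z₀ : ℂ) :
    conj (operatorKernel α t z₀ τ) * operatorKernel α t z τ =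
      ((operatorConst α ^ 2 : ℝ) : ℂ) * (z * conj z₀) *
        (((((t - τ) ^ (α + 2))⁻¹ : ℝ) : ℂ) *
          Complex.exp (-(((α ^ 2 / 4 : ℝ) : ℂ) *
            (z ^ ((2 / α : ℝ) : ℂ) + conj (z₀ ^ ((2 / α : ℝ) : ℂ)))) / ((t : ℂ) - τ))) := by
  have hpow : (t - τ) ^ (α + 2) = (t - τ) ^ (α / 2 + 1) * (t - τ) ^ (α / 2 + 1) := by
    rw [← Real.rpow_add (sub_pos.2 hτ)]
    ring_nf
  have hexp : ∀ w w₀ : ℂ, -(((α ^ 2 / 4 : ℝ) : ℂ) * (w + conj w₀)) / ((t : ℂ) - τ) =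
      conj (((-(α ^ 2 / 4 * (t - τ)⁻¹) : ℝ) : ℂ) * w₀) +
        ((-(α ^ 2 / 4 * (t - τ)⁻¹) : ℝ) : ℂ) * w := by
    intro w w₀
    rw [map_mul, Complex.conj_ofReal, div_eq_mul_inv]
    push_cast
    ring
  rw [hexp, Complex.exp_add, Complex.exp_conj, hpow]
  simp only [operatorKernel, neg_sq_mul_div_four_mul_sub, map_mul, map_div₀, Complex.conj_ofReal]
  push_cast
  ring

lemma operatorConst_sq_mul_Gamma (hα : 0 < α) :
    operatorConst α ^ 2 * (Real.Gamma (α + 1) * (α ^ 2 / 4) ^ (-(α + 1))) = kernelConst α := by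
  have hpow : (α ^ 2 / 4) ^ (-(α + 1)) = ((α / 2) ^ α * (α / 2) ^ α * (α / 2) ^ 2)⁻¹ := by
    rw [show α ^ 2 / 4 = α / 2 * (α / 2) by ring, Real.mul_rpow (by positivity) (by positivity),
      Real.rpow_neg (by positivity), Real.rpow_add_one (by positivity)]
    field_simp
  rw [hpow, operatorConst, kernelConst]
  field_simp

lemma integral_conj_operatorKernel_mul_operatorKernel (hα : 0 < α) (ht : 0 < t) {z z₀ : ℂ}
    (hz : z ∈ sector α) (hz₀ : z₀ ∈ sector α) :
    ∫ τ, conj (operatorKernel α t z₀ τ) * operatorKernel α t z τ ∂dataMeasure α t =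
      sectorKernel α t z₀ z := by
  set u : ℂ := z ^ ((2 / α : ℝ) : ℂ) + conj (z₀ ^ ((2 / α : ℝ) : ℂ)) with hu
  have hure : 0 < u.re := add_pos (rePow_pos hα hz) (rePow_pos hα hz₀)
  have hβ : 0 < (((α ^ 2 / 4 : ℝ) : ℂ) * u).re := by
    rw [Complex.re_ofReal_mul]
    positivity
  have hpow : (((α ^ 2 / 4) ^ (-(α + 1)) : ℝ) : ℂ) = ((α ^ 2 / 4 : ℝ) : ℂ) ^ ((-(α + 1) : ℝ) : ℂ) :=
    Complex.ofReal_cpow (by positivity) _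
  calc ∫ τ, conj (operatorKernel α t z₀ τ) * operatorKernel α t z τ ∂dataMeasure α t
      = ∫ τ in Set.Ioo 0 t, ((operatorConst α ^ 2 / t ^ α : ℝ) : ℂ) * (z * conj z₀) *
          (((τ ^ α / (t - τ) ^ (α + 2) : ℝ) : ℂ) *
            Complex.exp (-(((α ^ 2 / 4 : ℝ) : ℂ) * u) / ((t : ℂ) - τ))) := by
        rw [integral_dataMeasure]
        refine setIntegral_congr_fun measurableSet_Ioo fun τ hτ => ?_
        simp only [conj_operatorKernel_mul_operatorKernel hτ.2, ← hu, Complex.real_smul]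
        push_cast
        ring
    _ = ((operatorConst α ^ 2 / t ^ α : ℝ) : ℂ) * (z * conj z₀) *
          ((t ^ α : ℝ) * Complex.exp (-(((α ^ 2 / (4 * t) : ℝ) : ℂ) * u)) *
            ((Real.Gamma (α + 1) : ℂ) *
              (((α ^ 2 / 4) ^ (-(α + 1)) : ℝ) * u ^ ((-(α + 1) : ℝ) : ℂ)))) := by
        rw [integral_const_mul, setIntegral_Ioo_rpow_mul_cexp_div (by linarith) ht hβ,
          ofReal_mul_cpow (by positivity) (ne_zero_of_re_pos hure), hpow]
        congr 4
        push_cast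
        field_simp
    _ = ((operatorConst α ^ 2 * (Real.Gamma (α + 1) * (α ^ 2 / 4) ^ (-(α + 1))) : ℝ) : ℂ) *
          (z * conj z₀) * Complex.exp (-(((α ^ 2 / (4 * t) : ℝ) : ℂ) * u)) *
            u ^ ((-(α + 1) : ℝ) : ℂ) := by
        have htα : ((t ^ α : ℝ) : ℂ) ≠ 0 := Complex.ofReal_ne_zero.2 (by positivity)
        push_cast
        field_simp
    _ = sectorKernel α t z₀ z := by
        rw [operatorConst_sq_mul_Gamma hα, sectorKernel, halfPlaneKernel]

lemma inner_featureMap_featureMap (hα : 0 < α) (hα2 : α ≤ 2) (ht : 0 < t) (z z₀ : sector α) :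
    ⟪featureMap hα hα2 ht z, featureMap hα hα2 ht z₀⟫_ℂ = sectorKernel α t z₀ z := by
  rw [← integral_conj_operatorKernel_mul_operatorKernel hα ht z.2 z₀.2, L2.inner_def]
  refine integral_congr_ae ((inner_featureMap_ae hα hα2 ht _ z).trans ?_)
  filter_upwards [(memLp_conj_operatorKernel hα hα2 ht z₀).coeFn_toLp] with τ hτ
  rw [featureMap, hτ]

end GramKernel

section Totality

variable {α t : ℝ}

lemma measurableEmbedding_neg_sq_div_mul_inv_sub (hα : α ≠ 0) (t : ℝ) :
    MeasurableEmbedding fun τ : ℝ => -(α ^ 2 / 4 * (t - τ)⁻¹) := by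
  refine Measurable.measurableEmbedding (by fun_prop) fun τ τ' h => ?_
  exact sub_right_injective (inv_injective
    (mul_left_cancel₀ (by positivity : α ^ 2 / 4 ≠ 0) (neg_injective h)))

lemma operatorKernel_cpow_half (hα : 0 < α) (hα2 : α ≤ 2) (t x τ : ℝ) :
    operatorKernel α t ((1 + x * Complex.I) ^ ((α / 2 : ℝ) : ℂ)) τ =
      (1 + x * Complex.I) ^ ((α / 2 : ℝ) : ℂ) * (operatorKernel α t 1 τ *
        Complex.exp (x * ((-(α ^ 2 / 4 * (t - τ)⁻¹) : ℝ) : ℂ) * Complex.I)) := by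
  have hre : 0 < (1 + x * Complex.I : ℂ).re := by simp
  have hexp : ∀ c : ℂ, Complex.exp (c * (1 + x * Complex.I)) =
      Complex.exp (c * 1) * Complex.exp (x * c * Complex.I) := by
    intro c
    rw [← Complex.exp_add]
    ring_nf
  simp only [operatorKernel, neg_sq_mul_div_four_mul_sub, cpow_half_cpow_two_div hα hα2 hre,
    Complex.one_cpow, hexp]
  ring

lemma one_mem_sector (hα : 0 < α) : (1 : ℂ) ∈ sector α := by
  refine ⟨one_ne_zero, ?_⟩
  rw [Complex.arg_one, abs_zero]
  positivity

/-- Along `z ^ (2 / α) = 1 + i x` the transform is a Fourier transform in `(t - τ)⁻¹`. -/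
lemma ae_eq_zero_of_sectorOperator_eq_zero (hα : 0 < α) (hα2 : α ≤ 2) {g : ℝ → ℂ}
    (hg : Integrable (fun τ => g τ * operatorKernel α t 1 τ) (dataMeasure α t))
    (h0 : ∀ z, sectorOperator α t g z = 0) : g =ᵐ[dataMeasure α t] 0 := by
  have hfourier : ∀ x : ℝ, ∫ τ, g τ * operatorKernel α t 1 τ *
      Complex.exp (x * ((-(α ^ 2 / 4 * (t - τ)⁻¹) : ℝ) : ℂ) * Complex.I) ∂dataMeasure α t = 0 := by
    intro x
    have hmem : (1 + x * Complex.I : ℂ) ^ ((α / 2 : ℝ) : ℂ) ∈ sector α :=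
      cpow_half_mem_sector hα hα2 (by simp)
    refine mul_left_cancel₀ hmem.1 ?_
    rw [mul_zero, ← h0 ⟨_, hmem⟩, ← integral_mul_operatorKernel, ← integral_const_mul]
    simp only [operatorKernel_cpow_half hα hα2]
    ring_nf
  filter_upwards [ae_eq_zero_of_integral_mul_cexp_eq_zero hg
    (measurableEmbedding_neg_sq_div_mul_inv_sub hα.ne' t) hfourier, ae_dataMeasure_mem α t]
    with τ hτ hmem
  exact (mul_eq_zero.1 hτ).resolve_right (operatorKernel_ne_zero hα hmem.2 one_ne_zero)

lemma dense_span_featureMap (hα : 0 < α) (hα2 : α ≤ 2) (ht : 0 < t) :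
    Dense (Submodule.span ℂ (Set.range (featureMap hα hα2 ht)) :
      Set (Lp ℂ 2 (dataMeasure α t))) := by
  rw [Submodule.dense_iff_topologicalClosure_eq_top, Submodule.topologicalClosure_eq_top_iff,
    Submodule.eq_bot_iff]
  intro g hg
  refine (Lp.eq_zero_iff_ae_eq_zero).2 (ae_eq_zero_of_sectorOperator_eq_zero hα hα2
    (integrable_mul_operatorKernel hα hα2 ht g ⟨1, one_mem_sector hα⟩) fun z => ?_)
  rw [← inner_featureMap hα hα2 ht]
  exact (Submodule.mem_orthogonal _ _).1 hg _ (Submodule.subset_span ⟨z, rfl⟩)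

end Totality

section ImageSpace

variable {α t : ℝ}

lemma imageMultiplier_ne_zero (z : sector α) : imageMultiplier α t z ≠ 0 :=
  mul_ne_zero (Complex.cpow_ne_zero_iff.2 (.inl z.2.1)) (Complex.exp_ne_zero _)

lemma inv_imageMultiplier (z : sector α) : (imageMultiplier α t z)⁻¹ =
    (z : ℂ) ^ (((1 - α) * (α + 2) / (2 * α) : ℝ) : ℂ) *
      Complex.exp (((α : ℂ) ^ 2 / (4 * (t : ℂ))) * (z : ℂ) ^ ((2 / α : ℝ) : ℂ)) := by
  rw [imageMultiplier, mul_inv, ← Complex.exp_neg, ← Complex.cpow_neg, ← Complex.ofReal_neg]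
  ring_nf

lemma HolomorphicOnSector.mul {f g : sector α → ℂ} (hf : HolomorphicOnSector α f)
    (hg : HolomorphicOnSector α g) : HolomorphicOnSector α (fun z => f z * g z) := by
  obtain ⟨h, hh, hfh⟩ := hf
  obtain ⟨k, hk, hgk⟩ := hg
  exact ⟨fun z => h z * k z, hh.mul hk, fun z => by simp only [hfh, hgk]⟩

lemma HolomorphicOnSector.inv {f : sector α → ℂ} (hf : HolomorphicOnSector α f)
    (hf0 : ∀ z, f z ≠ 0) : HolomorphicOnSector α (fun z => (f z)⁻¹) := by
  obtain ⟨h, hh, hfh⟩ := hf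
  exact ⟨fun z => (h z)⁻¹, hh.inv fun z hz => hfh ⟨z, hz⟩ ▸ hf0 ⟨z, hz⟩,
    fun z => by simp only [hfh]⟩

lemma holomorphicOnSector_imageMultiplier (hα2 : α ≤ 2) :
    HolomorphicOnSector α (imageMultiplier α t) := by
  have hpow := differentiableOn_cpow_sector hα2
  exact ⟨_, (hpow _).mul ((hpow _).const_mul _).cexp, fun _ => rfl⟩

lemma norm_imageMultiplier (z : sector α) :
    ‖imageMultiplier α t z‖ = ‖(z : ℂ)‖ ^ ((α - 1) * (α + 2) / (2 * α)) *
      Real.exp (-(α ^ 2 / (4 * t)) * rePow α z) := by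
  have harg : -((α : ℂ) ^ 2 / (4 * (t : ℂ))) = ((-(α ^ 2 / (4 * t)) : ℝ) : ℂ) := by
    push_cast
    ring
  rw [imageMultiplier, norm_mul, Complex.norm_cpow_real, harg, Complex.norm_exp,
    Complex.re_ofReal_mul, ← rePow]

lemma norm_sq_imageMultiplier_mul_sectorDensity (hα : α ≠ 0) (z : sector α) :
    ‖imageMultiplier α t z‖ ^ 2 * sectorDensity α t z = densityConst α * bergmanWeight α z := by
  have hz : 0 < ‖(z : ℂ)‖ := norm_pos_iff.2 z.2.1
  have hpow : (‖(z : ℂ)‖ ^ ((α - 1) * (α + 2) / (2 * α))) ^ 2 * ‖(z : ℂ)‖ ^ (4 * (1 - α) / α) =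
      ‖(z : ℂ)‖ ^ ((α - 2) * (α - 1) / α) := by
    rw [← Real.rpow_natCast, ← Real.rpow_mul hz.le, ← Real.rpow_add hz]
    congr 1
    push_cast
    field_simp
    ring
  have hexp : Real.exp (-(α ^ 2 / (4 * t)) * rePow α z) ^ 2 *
      Real.exp (α ^ 2 / (2 * t) * rePow α z) = 1 := by
    rw [← Real.exp_nat_mul, ← Real.exp_add, Real.exp_eq_one_iff]
    push_cast
    ring
  rw [norm_imageMultiplier, sectorDensity, bergmanWeight, ← hpow]
  linear_combination (densityConst α * ((‖(z : ℂ)‖ ^ ((α - 1) * (α + 2) / (2 * α))) ^ 2 *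
    ‖(z : ℂ)‖ ^ (4 * (1 - α) / α)) * rePow α z ^ (α - 1)) * hexp

lemma sectorDensity_smul_norm_sq_imageMultiplier_mul (hα : α ≠ 0) (f : sector α → ℂ)
    (z : sector α) :
    sectorDensity α t z • ‖imageMultiplier α t z * f z‖ ^ 2 =
      densityConst α * (‖f z‖ ^ 2 * bergmanWeight α z) := by
  rw [norm_mul, mul_pow, smul_eq_mul]
  linear_combination ‖f z‖ ^ 2 * norm_sq_imageMultiplier_mul_sectorDensity (t := t) hα z

lemma integrable_norm_sq_imageMultiplier_mul_iff (hα : 0 < α) (f : sector α → ℂ) :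
    Integrable (fun z => ‖imageMultiplier α t z * f z‖ ^ 2) (sectorMeasure α t) ↔
      Integrable (fun z : sector α => ‖f z‖ ^ 2 * bergmanWeight α z) (areaMeasure α) := by
  rw [integrable_sectorMeasure_iff_integrable_areaMeasure hα]
  simp only [sectorDensity_smul_norm_sq_imageMultiplier_mul hα.ne']
  exact integrable_const_mul_iff (densityConst_pos hα).ne'.isUnit _

lemma integral_norm_sq_imageMultiplier_mul (hα : 0 < α) (f : sector α → ℂ) :
    ∫ z, ‖imageMultiplier α t z * f z‖ ^ 2 ∂sectorMeasure α t =
      densityConst α * ∫ z : sector α, ‖f z‖ ^ 2 * bergmanWeight α z ∂areaMeasure α := by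
  rw [integral_sectorMeasure_eq_integral_areaMeasure hα, ← integral_const_mul]
  simp only [sectorDensity_smul_norm_sq_imageMultiplier_mul hα.ne']

lemma mem_imageSpace_iff (hα : 0 < α) (hα2 : α ≤ 2) (F : sector α → ℂ) :
    F ∈ imageSpace α t ↔ HolomorphicOnSector α F ∧ MemLp F 2 (sectorMeasure α t) := by
  have hmult := holomorphicOnSector_imageMultiplier (t := t) hα2
  constructor
  · rintro ⟨f, ⟨hf, hfint⟩, rfl⟩
    have hhol : HolomorphicOnSector α fun z => imageMultiplier α t z * f z := hmult.mul hf
    exact ⟨hhol, (memLp_two_iff_integrable_sq_norm hhol.continuous.aestronglyMeasurable).2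
      ((integrable_norm_sq_imageMultiplier_mul_iff hα f).2 hfint)⟩
  · rintro ⟨hF, hF2⟩
    have hcancel : ∀ z, imageMultiplier α t z * ((imageMultiplier α t z)⁻¹ * F z) = F z :=
      fun z => mul_inv_cancel_left₀ (imageMultiplier_ne_zero z) _
    refine ⟨fun z => (imageMultiplier α t z)⁻¹ * F z,
      ⟨(hmult.inv imageMultiplier_ne_zero).mul hF, ?_⟩, funext hcancel⟩
    rw [← integrable_norm_sq_imageMultiplier_mul_iff (t := t) hα]
    simp only [hcancel]
    exact (memLp_two_iff_integrable_sq_norm hF.continuous.aestronglyMeasurable).1 hF2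

lemma bergmanInner_self (α : ℝ) (f : sector α → ℂ) :
    bergmanInner α f f = (((α * Real.pi ^ (1 / 2 : ℝ)) ^ (α - 1) *
      ∫ z : sector α, ‖f z‖ ^ 2 * bergmanWeight α z ∂areaMeasure α : ℝ) : ℂ) := by
  simp only [bergmanInner, Complex.mul_conj, Complex.normSq_eq_norm_sq, ← Complex.ofReal_mul,
    integral_complex_ofReal]

lemma sq_imageNorm_const_mul_bergmanInner_const (hα : 0 < α) :
    (ProbabilityTheory.beta (α / 2) (α / 2) ^ (1 / 2 : ℝ) /
      ((α / 2) ^ ((α - 1) / 2) * Real.pi ^ ((α + 1) / 4))) ^ 2 *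
      (α * Real.pi ^ (1 / 2 : ℝ)) ^ (α - 1) = densityConst α := by
  have hbeta : 0 < ProbabilityTheory.beta (α / 2) (α / 2) :=
    ProbabilityTheory.beta_pos (by positivity) (by positivity)
  have hpi := Real.pi_pos
  have hbetaSq : (ProbabilityTheory.beta (α / 2) (α / 2) ^ (1 / 2 : ℝ)) ^ 2 =
      ProbabilityTheory.beta (α / 2) (α / 2) := by
    rw [← Real.sqrt_eq_rpow, Real.sq_sqrt hbeta.le]
  have hhalfSq : ((α / 2) ^ ((α - 1) / 2)) ^ 2 = α ^ (α - 1) / 2 ^ (α - 1) := by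
    rw [← Real.rpow_natCast, ← Real.rpow_mul (by positivity), ← Real.div_rpow hα.le two_pos.le]
    congr 1
    push_cast
    ring
  have hpiSq : (Real.pi ^ ((α + 1) / 4)) ^ 2 = (Real.pi ^ (1 / 2 : ℝ)) ^ (α - 1) * Real.pi := by
    rw [← Real.rpow_natCast, ← Real.rpow_mul hpi.le, ← Real.rpow_mul hpi.le,
      ← Real.rpow_add_one hpi.ne']
    congr 1
    push_cast
    ring
  rw [div_pow, mul_pow, hbetaSq, hhalfSq, hpiSq, Real.mul_rpow hα.le (by positivity), densityConst]
  field_simp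

lemma imageNorm_eq_sqrt_integral (hα : 0 < α) (F : sector α → ℂ) :
    imageNorm α t F = Real.sqrt (∫ z, ‖F z‖ ^ 2 ∂sectorMeasure α t) := by
  have hbeta : 0 < ProbabilityTheory.beta (α / 2) (α / 2) :=
    ProbabilityTheory.beta_pos (by positivity) (by positivity)
  have hnormSq := integral_norm_sq_imageMultiplier_mul (t := t) hα
    fun z => (imageMultiplier α t z)⁻¹ * F z
  simp only [mul_inv_cancel_left₀ (imageMultiplier_ne_zero _)] at hnormSq
  simp only [imageNorm, ← inv_imageMultiplier, bergmanNorm, bergmanInner_self, Complex.ofReal_re]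
  rw [hnormSq, ← sq_imageNorm_const_mul_bergmanInner_const hα, mul_assoc (_ ^ 2),
    Real.sqrt_mul (sq_nonneg _), Real.sqrt_sq (by positivity)]

end ImageSpace

section Holomorphy

variable {α t : ℝ}

lemma HolomorphicOnSector.add {f g : sector α → ℂ} (hf : HolomorphicOnSector α f)
    (hg : HolomorphicOnSector α g) : HolomorphicOnSector α (fun z => f z + g z) := by
  obtain ⟨h, hh, hfh⟩ := hf
  obtain ⟨k, hk, hgk⟩ := hg
  exact ⟨fun z => h z + k z, hh.add hk, fun z => by simp only [hfh, hgk]⟩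

lemma holomorphicOnSector_const (α : ℝ) (c : ℂ) : HolomorphicOnSector α fun _ => c :=
  ⟨fun _ => c, differentiableOn_const c, fun _ => rfl⟩

lemma holomorphicOnSector_iff_extend {f : sector α → ℂ} : HolomorphicOnSector α f ↔
    DifferentiableOn ℂ (Function.extend Subtype.val f 0) (sector α) := by
  constructor
  · rintro ⟨h, hh, hf⟩
    refine hh.congr fun z hz => ?_
    exact (Subtype.val_injective.extend_apply f 0 ⟨z, hz⟩).trans (hf ⟨z, hz⟩)
  · exact fun h => ⟨_, h, fun z => (Subtype.val_injective.extend_apply f 0 z).symm⟩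

lemma holomorphicOnSector_of_tendstoLocallyUniformly (hα2 : α ≤ 2) {f : ℕ → sector α → ℂ}
    {f₀ : sector α → ℂ} (hlim : TendstoLocallyUniformly f f₀ atTop)
    (hf : ∀ n, HolomorphicOnSector α (f n)) : HolomorphicOnSector α f₀ := by
  have hextend : TendstoLocallyUniformlyOn (fun n => Function.extend Subtype.val (f n) 0)
      (Function.extend Subtype.val f₀ 0) atTop (sector α) := by
    rw [tendstoLocallyUniformlyOn_iff_tendstoLocallyUniformly_comp_coe]
    simpa only [Subtype.val_injective.extend_apply, Function.extend_comp Subtype.val_injective]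
  exact holomorphicOnSector_iff_extend.2 <| hextend.differentiableOn
    (.of_forall fun n => holomorphicOnSector_iff_extend.1 (hf n)) (isOpen_sector hα2)

lemma tendstoLocallyUniformly_inner {𝕜 X H : Type*} [RCLike 𝕜] [TopologicalSpace X]
    [LocallyCompactSpace X] [NormedAddCommGroup H] [InnerProductSpace 𝕜 H] {k : X → H}
    (hk : ∀ K, IsCompact K → ∃ M, ∀ x ∈ K, ‖k x‖ ≤ M) {u : ℕ → H} {g : H}
    (hu : Tendsto u atTop (𝓝 g)) :
    TendstoLocallyUniformly (fun n x => ⟪k x, u n⟫_𝕜) (fun x => ⟪k x, g⟫_𝕜) atTop := by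
  rw [tendstoLocallyUniformly_iff_forall_isCompact]
  intro K hK
  obtain ⟨M, hM⟩ := hk K hK
  have hbound : Tendsto (fun n => M * ‖u n - g‖) atTop (𝓝 0) := by
    simpa using (tendsto_iff_norm_sub_tendsto_zero.1 hu).const_mul M
  rw [Metric.tendstoUniformlyOn_iff]
  intro ε hε
  filter_upwards [hbound.eventually (gt_mem_nhds hε)] with n hn x hx
  calc dist ⟪k x, g⟫_𝕜 ⟪k x, u n⟫_𝕜 = ‖⟪k x, u n - g⟫_𝕜‖ := by
        rw [dist_comm, dist_eq_norm, ← inner_sub_right]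
    _ ≤ ‖k x‖ * ‖u n - g‖ := norm_inner_le_norm _ _
    _ ≤ M * ‖u n - g‖ := mul_le_mul_of_nonneg_right (hM x hx) (norm_nonneg _)
    _ < ε := hn

lemma exists_norm_featureMap_le (hα : 0 < α) (hα2 : α ≤ 2) (ht : 0 < t) {E : Set (sector α)}
    (hE : IsCompact E) : ∃ M, ∀ z ∈ E, ‖featureMap hα hα2 ht z‖ ≤ M := by
  have := isFiniteMeasure_dataMeasure hα ht
  obtain ⟨M, hM⟩ := exists_norm_operatorKernel_le t hα hα2 hE
  refine ⟨_, fun z hz => Lp.norm_le_of_ae_bound (C := M)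
    ((norm_nonneg _).trans (hM z hz 0 ht)) ?_⟩
  filter_upwards [(memLp_conj_operatorKernel hα hα2 ht z).coeFn_toLp, ae_dataMeasure_mem α t]
    with τ hτ hmem
  rw [featureMap, hτ, RCLike.norm_conj]
  exact hM z hz τ hmem.2

lemma holomorphicOnSector_inner_featureMap_featureMap (hα : 0 < α) (hα2 : α ≤ 2) (ht : 0 < t)
    (z₀ : sector α) :
    HolomorphicOnSector α fun z => ⟪featureMap hα hα2 ht z, featureMap hα hα2 ht z₀⟫_ℂ := by
  simp only [inner_featureMap_featureMap]
  exact ⟨_, differentiableOn_sectorKernel hα hα2 z₀.2, fun _ => rfl⟩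

lemma holomorphicOnSector_inner_featureMap_of_mem_span (hα : 0 < α) (hα2 : α ≤ 2) (ht : 0 < t)
    {g : Lp ℂ 2 (dataMeasure α t)}
    (hg : g ∈ Submodule.span ℂ (Set.range (featureMap hα hα2 ht))) :
    HolomorphicOnSector α fun z => ⟪featureMap hα hα2 ht z, g⟫_ℂ := by
  induction hg using Submodule.span_induction with
  | mem _ hx =>
    obtain ⟨z₀, rfl⟩ := hx
    exact holomorphicOnSector_inner_featureMap_featureMap hα hα2 ht z₀
  | zero => simpa only [inner_zero_right] using holomorphicOnSector_const α 0
  | add _ _ _ _ hx hy => simpa only [inner_add_right] using hx.add hy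
  | smul c _ _ hx =>
    simpa only [inner_smul_right] using (holomorphicOnSector_const α c).mul hx

lemma holomorphicOnSector_sectorOperator (hα : 0 < α) (hα2 : α ≤ 2) (ht : 0 < t)
    (g : Lp ℂ 2 (dataMeasure α t)) : HolomorphicOnSector α (sectorOperator α t g) := by
  have := (isOpen_sector hα2).locallyCompactSpace
  obtain ⟨u, hu, hug⟩ := mem_closure_iff_seq_limit.1 (dense_span_featureMap hα hα2 ht g)
  have hlim := tendstoLocallyUniformly_inner (𝕜 := ℂ)
    (fun _ hK => exists_norm_featureMap_le hα hα2 ht hK) hug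
  simpa only [inner_featureMap] using holomorphicOnSector_of_tendstoLocallyUniformly hα2 hlim
    fun n => holomorphicOnSector_inner_featureMap_of_mem_span hα hα2 ht (hu n)

end Holomorphy

section Isometry

variable {α t : ℝ}

lemma integral_mul_conj_inner_featureMap (hα : 0 < α) (hα2 : α ≤ 2) (ht : 0 < t)
    {F : sector α → ℂ} (hF : HolomorphicOnSector α F) (hF2 : MemLp F 2 (sectorMeasure α t))
    (z₀ : sector α) :
    ∫ z, F z * conj ⟪featureMap hα hα2 ht z, featureMap hα hα2 ht z₀⟫_ℂ ∂sectorMeasure α t =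
      F z₀ := by
  obtain ⟨h, hh, hFh⟩ := hF
  have hint := (memLp_two_iff_integrable_sq_norm hF2.1).1 hF2
  simp only [hFh, inner_featureMap_featureMap] at hint ⊢
  exact integral_mul_conj_sectorKernel hα hα2 hh hint z₀.2

lemma memLp_inner_featureMap_featureMap (hα : 0 < α) (hα2 : α ≤ 2) (ht : 0 < t) (z₀ : sector α) :
    MemLp (fun z => ⟪featureMap hα hα2 ht z, featureMap hα hα2 ht z₀⟫_ℂ) 2
      (sectorMeasure α t) := by
  refine (memLp_two_iff_integrable_sq_norm (holomorphicOnSector_inner_featureMap_featureMap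
    hα hα2 ht z₀).continuous.aestronglyMeasurable).2 ?_
  simp only [inner_featureMap_featureMap]
  exact integrable_norm_sq_sectorKernel hα hα2 z₀.2

lemma isReproducingFamily_featureMap (hα : 0 < α) (hα2 : α ≤ 2) (ht : 0 < t) :
    IsReproducingFamily ℂ (sectorMeasure α t) (featureMap hα hα2 ht) where
  memLp := memLp_inner_featureMap_featureMap hα hα2 ht
  integral_inner_mul_conj_inner z₀ z₁ := integral_mul_conj_inner_featureMap hα hα2 ht
    (holomorphicOnSector_inner_featureMap_featureMap hα hα2 ht z₀)
    (memLp_inner_featureMap_featureMap hα hα2 ht z₀) z₁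

/-- The operator `L_t^α` as an isometry into `L²(sectorMeasure α t)`. -/
noncomputable def sectorIsometry (hα : 0 < α) (hα2 : α ≤ 2) (ht : 0 < t) :
    Lp ℂ 2 (dataMeasure α t) →ₗᵢ[ℂ] Lp ℂ 2 (sectorMeasure α t) :=
  (isReproducingFamily_featureMap hα hα2 ht).isometry (dense_span_featureMap hα hα2 ht)

lemma coeFn_sectorIsometry (hα : 0 < α) (hα2 : α ≤ 2) (ht : 0 < t)
    (g : Lp ℂ 2 (dataMeasure α t)) :
    sectorIsometry hα hα2 ht g =ᵐ[sectorMeasure α t] sectorOperator α t g :=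
  ((isReproducingFamily_featureMap hα hα2 ht).coeFn_isometry (dense_span_featureMap hα hα2 ht)
    g).trans (.of_forall fun z => inner_featureMap hα hα2 ht g z)

lemma sectorOperator_mem_imageSpace (hα : 0 < α) (hα2 : α ≤ 2) (ht : 0 < t)
    (g : Lp ℂ 2 (dataMeasure α t)) : sectorOperator α t g ∈ imageSpace α t :=
  (mem_imageSpace_iff hα hα2 _).2 ⟨holomorphicOnSector_sectorOperator hα hα2 ht g,
    (memLp_congr_ae (coeFn_sectorIsometry hα hα2 ht g)).1 (Lp.memLp _)⟩

lemma imageNorm_sectorOperator (hα : 0 < α) (hα2 : α ≤ 2) (ht : 0 < t)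
    (g : Lp ℂ 2 (dataMeasure α t)) : imageNorm α t (sectorOperator α t g) = ‖g‖ := by
  have hnormSq := norm_toLp_two_sq (Lp.memLp (sectorIsometry hα hα2 ht g))
  rw [Lp.toLp_coeFn, LinearIsometry.norm_map] at hnormSq
  rw [imageNorm_eq_sqrt_integral hα, ← Real.sqrt_sq (norm_nonneg g), hnormSq]
  congr 1
  refine integral_congr_ae ?_
  filter_upwards [coeFn_sectorIsometry hα hα2 ht g] with z hz
  rw [hz]

lemma memLp_of_mem_imageSpace (hα : 0 < α) (hα2 : α ≤ 2) (F : imageSpace α t) :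
    MemLp (F : sector α → ℂ) 2 (sectorMeasure α t) :=
  ((mem_imageSpace_iff hα hα2 _).1 F.2).2

lemma sectorOperator_adjoint_toLp (hα : 0 < α) (hα2 : α ≤ 2) (ht : 0 < t) (F : imageSpace α t) :
    sectorOperator α t (ContinuousLinearMap.adjoint
      (sectorIsometry hα hα2 ht).toContinuousLinearMap (memLp_of_mem_imageSpace hα hα2 F).toLp) =
      F := by
  funext z
  obtain ⟨hF, hF2⟩ := (mem_imageSpace_iff hα hα2 _).1 F.2
  rw [← inner_featureMap hα hα2 ht, ← integral_mul_conj_inner_featureMap hα hα2 ht hF hF2 z]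
  exact inner_adjoint_toLp_eq (U := (sectorIsometry hα hα2 ht).toContinuousLinearMap)
    ((isReproducingFamily_featureMap hα hα2 ht).coeFn_isometry (dense_span_featureMap hα hα2 ht))
    hF2 _

lemma adjoint_sectorIsometry_toLp (hα : 0 < α) (hα2 : α ≤ 2) (ht : 0 < t)
    (g : Lp ℂ 2 (dataMeasure α t)) (hg : MemLp (sectorOperator α t g) 2 (sectorMeasure α t)) :
    ContinuousLinearMap.adjoint (sectorIsometry hα hα2 ht).toContinuousLinearMap hg.toLp = g := by
  have htoLp : hg.toLp = sectorIsometry hα hα2 ht g :=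
    Lp.ext (hg.coeFn_toLp.trans (coeFn_sectorIsometry hα hα2 ht g).symm)
  rw [htoLp]
  exact DFunLike.congr_fun (sectorIsometry hα hα2 ht).adjoint_comp_self g

/-- The operator `L_t^α` as a linear bijection onto `imageSpace`; its inverse is the adjoint of
`sectorIsometry`. -/
noncomputable def operatorEquiv (hα : 0 < α) (hα2 : α ≤ 2) (ht : 0 < t) :
    Lp ℂ 2 (dataMeasure α t) ≃ₗ[ℂ] imageSpace α t where
  toFun g := ⟨sectorOperator α t g, sectorOperator_mem_imageSpace hα hα2 ht g⟩
  map_add' g g' := Subtype.ext <| funext fun z => by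
    simp only [Submodule.coe_add, Pi.add_apply, ← inner_featureMap hα hα2 ht, inner_add_right]
  map_smul' c g := Subtype.ext <| funext fun z => by
    simp only [Submodule.coe_smul, Pi.smul_apply, ← inner_featureMap hα hα2 ht, inner_smul_right,
      RingHom.id_apply, smul_eq_mul]
  invFun F := ContinuousLinearMap.adjoint (sectorIsometry hα hα2 ht).toContinuousLinearMap
    (memLp_of_mem_imageSpace hα hα2 F).toLp
  left_inv g := adjoint_sectorIsometry_toLp hα hα2 ht g _
  right_inv F := Subtype.ext (sectorOperator_adjoint_toLp hα hα2 ht F)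

end Isometry

section Inversion

variable {α t : ℝ} {E : Set (sector α)} {F : sector α → ℂ}

lemma continuous_sectorDensity (hα : 0 < α) (hα2 : α ≤ 2) :
    Continuous fun z : sector α => sectorDensity α t z := by
  have hrePow := continuous_rePow_sector hα2
  have hnormPow : Continuous fun z : sector α => ‖(z : ℂ)‖ ^ (4 * (1 - α) / α) :=
    continuous_subtype_val.norm.rpow_const fun z => .inl (norm_ne_zero_iff.2 z.2.1)
  have hrePowPow : Continuous fun z : sector α => rePow α z ^ (α - 1) :=
    hrePow.rpow_const fun z => .inl (rePow_pos hα z.2).ne'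
  unfold sectorDensity
  fun_prop

lemma sectorMeasure_ne_top_of_isCompact (hα : 0 < α) (hα2 : α ≤ 2) (hE : IsCompact E) :
    sectorMeasure α t E ≠ ⊤ := by
  obtain ⟨C, hC⟩ := hE.exists_bound_of_continuousOn
    (continuous_sectorDensity (t := t) hα hα2).continuousOn
  have harea : areaMeasure α E < ⊤ := by
    rw [areaMeasure, comap_subtype_coe_apply (isOpen_sector hα2).measurableSet]
    exact (hE.image continuous_subtype_val).measure_lt_top
  rw [sectorMeasure_eq_withDensity, withDensity_apply _ hE.measurableSet, ← lt_top_iff_ne_top]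
  calc ∫⁻ z in E, ENNReal.ofReal (sectorDensity α t z) ∂areaMeasure α
      ≤ ∫⁻ _ in E, ENNReal.ofReal C ∂areaMeasure α :=
        setLIntegral_mono measurable_const fun z hz =>
          ENNReal.ofReal_le_ofReal ((le_abs_self _).trans (hC z hz))
    _ < ⊤ := by
        rw [setLIntegral_const]
        exact ENNReal.mul_lt_top ENNReal.ofReal_lt_top harea

lemma smul_inverseIntegrand (hα2 : α ≤ 2) (F : sector α → ℂ) (τ : ℝ) (z : sector α) :
    (((α / 2) ^ α / (Real.Gamma (α / 2) * (t - τ) ^ (α / 2 + 1)) : ℝ) : ℂ) *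
      inverseIntegrand α t F τ z = F z * conj (operatorKernel α t z τ) := by
  have hcpow : conj (z : ℂ) ^ ((2 / α : ℝ) : ℂ) = conj ((z : ℂ) ^ ((2 / α : ℝ) : ℂ)) := by
    rw [Complex.conj_cpow _ _
      (Complex.mem_slitPlane_iff_arg.1 (mem_slitPlane_of_mem_sector hα2 z.2)).1,
      Complex.conj_ofReal]
  simp only [inverseIntegrand, operatorKernel, operatorConst, neg_sq_mul_div_four_mul_sub, hcpow,
    map_mul, map_div₀, Complex.conj_ofReal, ← Complex.exp_conj]
  push_cast
  ring

lemma integrableOn_mul_conj_operatorKernel (hα : 0 < α) (hα2 : α ≤ 2) (hE : IsCompact E)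
    (hF : MemLp F 2 (sectorMeasure α t)) {τ : ℝ} (hτ : τ < t) :
    IntegrableOn (fun z : sector α => F z * conj (operatorKernel α t z τ)) E
      (sectorMeasure α t) := by
  have : IsFiniteMeasure ((sectorMeasure α t).restrict E) :=
    isFiniteMeasure_restrict.2 (sectorMeasure_ne_top_of_isCompact hα hα2 hE)
  obtain ⟨M, hM⟩ := exists_norm_operatorKernel_le t hα hα2 hE
  refine ((hF.restrict E).integrable one_le_two).mul_bdd (c := M) ?_ ?_
  · exact (measurable_conj_operatorKernel α t).of_uncurry_right.aestronglyMeasurable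
  · filter_upwards [ae_restrict_mem hE.measurableSet] with z hz
    exact (RCLike.norm_conj _).trans_le (hM z hz τ hτ)

lemma integrableOn_inverseIntegrand (hα : 0 < α) (hα2 : α ≤ 2) (hE : IsCompact E)
    (hF : MemLp F 2 (sectorMeasure α t)) {τ : ℝ} (hτ : τ < t) :
    IntegrableOn (inverseIntegrand α t F τ) E (sectorMeasure α t) := by
  have hconst : (((α / 2) ^ α / (Real.Gamma (α / 2) * (t - τ) ^ (α / 2 + 1)) : ℝ) : ℂ) ≠ 0 :=
    Complex.ofReal_ne_zero.2 (by positivity)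
  have hint := integrableOn_mul_conj_operatorKernel hα hα2 hE hF hτ
  simp only [← smul_inverseIntegrand hα2] at hint
  exact (integrable_const_mul_iff hconst.isUnit _).1 hint

lemma truncatedInverse_eq_setIntegral (hα2 : α ≤ 2) (F : sector α → ℂ) (E : Set (sector α)) :
    truncatedInverse α t F E =
      fun τ => ∫ z in E, F z * conj (operatorKernel α t z τ) ∂sectorMeasure α t := by
  funext τ
  rw [truncatedInverse, ← integral_const_mul]
  simp only [smul_inverseIntegrand hα2]

lemma ae_norm_conj_operatorKernel_le (hα : 0 < α) (hα2 : α ≤ 2) (hE : IsCompact E) :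
    ∃ M, ∀ᵐ τ ∂dataMeasure α t, ∀ z ∈ E, ‖conj (operatorKernel α t z τ)‖ ≤ M := by
  obtain ⟨M, hM⟩ := exists_norm_operatorKernel_le t hα hα2 hE
  refine ⟨M, ?_⟩
  filter_upwards [ae_dataMeasure_mem α t] with τ hτ z hz
  exact (RCLike.norm_conj _).trans_le (hM z hz τ hτ.2)

lemma memLp_truncatedInverse (hα : 0 < α) (hα2 : α ≤ 2) (ht : 0 < t) (hE : IsCompact E)
    (hF : MemLp F 2 (sectorMeasure α t)) :
    MemLp (truncatedInverse α t F E) 2 (dataMeasure α t) := by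
  have := isFiniteMeasure_dataMeasure hα ht
  obtain ⟨M, hM⟩ := ae_norm_conj_operatorKernel_le (t := t) hα hα2 hE
  rw [truncatedInverse_eq_setIntegral hα2]
  exact memLp_setIntegral_mul (measurable_conj_operatorKernel α t) hE.measurableSet
    (sectorMeasure_ne_top_of_isCompact hα hα2 hE) hM hF

lemma toLp_truncatedInverse (hα : 0 < α) (hα2 : α ≤ 2) (ht : 0 < t) (hE : IsCompact E)
    (hF : MemLp F 2 (sectorMeasure α t)) :
    (memLp_truncatedInverse hα hα2 ht hE hF).toLp =
      ContinuousLinearMap.adjoint (sectorIsometry hα hα2 ht).toContinuousLinearMap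
        (hF.indicator hE.measurableSet).toLp := by
  have := isFiniteMeasure_dataMeasure hα ht
  obtain ⟨M, hM⟩ := ae_norm_conj_operatorKernel_le (t := t) hα hα2 hE
  simp only [truncatedInverse_eq_setIntegral hα2]
  refine toLp_setIntegral_mul_eq_adjoint (measurable_conj_operatorKernel α t) hE.measurableSet
    (sectorMeasure_ne_top_of_isCompact hα hα2 hE) hM hF fun g => ?_
  exact (coeFn_sectorIsometry hα hα2 ht g).trans (.of_forall fun z => by
    simp only [Complex.conj_conj, integral_mul_operatorKernel])

lemma tendsto_toLp_truncatedInverse (hα : 0 < α) (hα2 : α ≤ 2) (ht : 0 < t) (F : imageSpace α t)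
    {E : ℕ → Set (sector α)} (hE : ∀ N, IsCompact (E N)) (hmono : Monotone E)
    (huniv : ⋃ N, E N = Set.univ) :
    Tendsto (fun N => (memLp_truncatedInverse hα hα2 ht (hE N)
      (memLp_of_mem_imageSpace hα hα2 F)).toLp) atTop (𝓝 ((operatorEquiv hα hα2 ht).symm F)) := by
  have hF := memLp_of_mem_imageSpace hα hα2 F
  simp only [fun N => toLp_truncatedInverse hα hα2 ht (hE N) hF]
  exact ((ContinuousLinearMap.continuous _).tendsto _).comp
    (tendsto_toLp_indicator hF (fun N => (hE N).measurableSet) hmono huniv)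

end Inversion

theorem theorem1p2 (α t : ℝ) (hα : 0 < α) (hα2 : α ≤ 2) (ht : 0 < t) :
    -- the integral that defines the operator converges absolutely at every point of the sector
    (∀ (g : Lp ℂ 2 (dataMeasure α t)) (z : sector α),
      IntegrableOn (operatorIntegrand α t g z) (Set.Ioo 0 t)) ∧
    -- the operator is an isometric linear bijection onto the image space
    ∃ T : Lp ℂ 2 (dataMeasure α t) ≃ₗ[ℂ] imageSpace α t,
      (∀ g : Lp ℂ 2 (dataMeasure α t), (T g : sector α → ℂ) = sectorOperator α t g) ∧
      (∀ g : Lp ℂ 2 (dataMeasure α t), imageNorm α t (T g : sector α → ℂ) = ‖g‖) ∧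
      -- the inverse formula, for every compact exhaustion of the sector
      ∀ (F : imageSpace α t) (E : ℕ → Set (sector α)),
        (∀ N, IsCompact (E N)) → Monotone E → (⋃ N, E N) = Set.univ →
          (∀ N, ∀ τ ∈ Set.Ioo 0 t,
            IntegrableOn (inverseIntegrand α t F τ) (E N) (sectorMeasure α t)) ∧
          ∃ hE : ∀ N, MemLp (truncatedInverse α t F (E N)) 2 (dataMeasure α t),
            Tendsto (fun N => (hE N).toLp (truncatedInverse α t F (E N))) atTop
              (𝓝 (T.symm F)) :=
  ⟨fun g z => (integrable_mul_operatorKernel_iff hα ht g z).1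
      (integrable_mul_operatorKernel hα hα2 ht g z),
    operatorEquiv hα hα2 ht, fun _ => rfl, imageNorm_sectorOperator hα hα2 ht,
    fun F _ hE hmono huniv =>
      ⟨fun N _ hτ => integrableOn_inverseIntegrand hα hα2 (hE N)
          (memLp_of_mem_imageSpace hα hα2 F) hτ.2,
        fun N => memLp_truncatedInverse hα hα2 ht (hE N) (memLp_of_mem_imageSpace hα hα2 F),
        tendsto_toLp_truncatedInverse hα hα2 ht F hE hmono huniv⟩⟩
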